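/- Let $r\ge 1$, let $a_1,\dots,a_{r+1}$ be positive integers, let $N=2(a_1+\dots+a_r)+a_{r+1}$, and let $\mathfrak{so}_N$ be the complex orthogonal Lie algebra of the symmetric form with matrix $J_N$, where $J_s$ denotes the $s\times s$ matrix with entries $1$ on the skew-diagonal and $0$ elsewhere. Let $\mathfrak p=\mathfrak g_0\oplus\mathfrak n\subset\mathfrak{so}_N$ be the standard (block upper triangular) parabolic subalgebra with block lengths $(a_1,\dots,a_r,a_{r+1},a_r,\dots,a_1)$, let $\mathfrak n$ be its nilradical (strictly block upper triangular matrices), and let $\mathfrak g_1$ be the space of elements of $\mathfrak{so}_N$ supported on the first block super-diagonal. An element $X\in\mathfrak n$ is a Richardson element for $\mathfrak p$ if $[\mathfrak p,X]=\mathfrak n$. Assume that $\mathfrak p$ is nice, i.e. that $\mathfrak g_1$ contains a Richardson element for $\mathfrak p$. Put $B_i=\lceil a_i/2\rceil$, $b_i=\lfloor a_i/2\rfloor$. For $s,t\ge 0$ let $C_i(s,t)$ be the $a_i\times a_{i+1}$ matrix with $J_s$ in its upper right corner, $J_t$ in its lower left corner and zeros elsewhere (the two corners may share a row or columns; all entries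 are $0$ or $1$). For $1\le i\le r$ define the $a_i\times a_{i+1}$ matrix $$X_i=\begin{cases}(0\ \ J_{a_i}\ \ 0)\text{ with } J_{a_i} \text{ in the middle columns} & \text{if } a_i\equiv a_{i+1}\pmod 2,\\ C_i(B_i-1,B_i) & \text{if } a_i=a_{i+1}+1,\ a_i\text{ even},\ i\text{ odd},\\ C_i(B_i,B_i-1) & \text{if } a_i=a_{i+1}+1,\ a_i\text{ even},\ i\text{ even},\\ C_i(B_i,B_i) & \text{otherwise.}\end{cases}$$ Let $X_R\in\mathfrak g_1$ be the matrix whose blocks on the block super-diagonal are $X_1,\dots,X_r,Y_r,\dots,Y_1$, where $Y_i$ is the negative of the skew-transpose (transpose about the skew-diagonal) of $X_i$. Let $1\le i\le r$ and let $\hat X_i$ be the following $a_i\times a_{i+1}$ matrix: if the sequence of block lengths is unimodal, any complex matrix of rank $a_i$ with exactly $a_i$ nonzero entries; if it is not unimodal, $\hat X_i=C_i(b_i,B_i)$ for $i$ odd and $\hat X_i=C_i(B_i,b_i)$ for $i$ even. Let $\hat X_R$ be obtained from $X_R$ by replacing $X_i$ by $\hat X_i$ and $Y_i$ by the negative $\hat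 Y_i$ of the skew-transpose of $\hat X_i$. (1) If $a_i$ is odd, $a_{i+1}$ is even and $a_i<a_{i+1}$ (so that the two blocks of $\hat X_i$ fit into disjoint columns), then $\hat X_R$ is a Richardson element for $\mathfrak p$ if and only if $N$ is odd and, for $l=i+1$, one has $l\le r$, $a_{l-1}=a_{l+1}$ and $a_l>a_{l+1}$. (2) If the sequence of block lengths is unimodal, $a_i$ is odd and $a_{i+1}$ is even, then $\hat X_R$ is not a Richardson element for $\mathfrak p$, for any $a_i\times a_{i+1}$ matrix $\hat X_i$ of rank $a_i$ with exactly $a_i$ nonzero entries. (3) If $N$ is odd and $2\le l\le r$ is such that $a_l=a_{l+1}+1$ and $a_{l-1}$ is odd, then the element $\hat X_R$ obtained with $i=l-1$ and $\hat X_{l-1}$ the explicit matrix above ($C_{l-1}(b_{l-1},B_{l-1})$ or $C_{l-1}(B_{l-1},b_{l-1})$ according to the parity of $l-1$) is a Richardson element for $\mathfrak p$ if and only if $a_{l-1}=a_{l+1}$. -/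

import Mathlib

attribute [local instance 100] LieRing.ofAssociativeRing

/-- Length of the `k`-th block (`k = 0, …, 2r`) of the palindromic sequence
`(a 1, …, a r, a (r+1), a r, …, a 1)` with `2r + 1` entries. -/
def blockLen (r : ℕ) (a : ℕ → ℕ) (k : Fin (2 * r + 1)) : ℕ :=
  a (min (k.val + 1) (2 * r + 1 - k.val))

theorem blockLen_rev (r : ℕ) (a : ℕ → ℕ) (k : Fin (2 * r + 1)) :
    blockLen r a k = blockLen r a k.rev := by
  have h := k.isLt
  unfold blockLen
  rw [Fin.val_rev]
  congr 1
  omega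

theorem blockLen_left (r : ℕ) (a : ℕ → ℕ) (k : Fin (2 * r + 1)) (h : k.val < r) :
    blockLen r a k = a (k.val + 1) := by
  unfold blockLen
  congr 1
  omega

theorem blockLen_next (r : ℕ) (a : ℕ → ℕ) (k k' : Fin (2 * r + 1)) (h : k.val < r)
    (h' : k'.val = k.val + 1) : blockLen r a k' = a (k.val + 1 + 1) := by
  unfold blockLen
  congr 1
  omega

/-- The size `N` of the matrices: the sum of all block lengths. -/
def totalSize (r : ℕ) (a : ℕ → ℕ) : ℕ := ∑ k : Fin (2 * r + 1), blockLen r a k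

/-- Row and column indices of `N × N`-matrices, written as pairs
(block, position in that block), ordered lexicographically. -/
abbrev Idx (r : ℕ) (a : ℕ → ℕ) : Type :=
  Σ k : Fin (2 * r + 1), Fin (blockLen r a k)

/-- The order-reversing involution of the indices (`j ↦ N + 1 - j` for indices `1, …, N`). -/
def flipIdx (r : ℕ) (a : ℕ → ℕ) (x : Idx r a) : Idx r a :=
  ⟨x.1.rev, Fin.cast (blockLen_rev r a x.1) x.2.rev⟩

/-- The matrix `J_N` with entries `1` on the skew-diagonal and `0` elsewhere. -/
def skewDiagForm (r : ℕ) (a : ℕ → ℕ) : Matrix (Idx r a) (Idx r a) ℂ :=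
  fun x y => if y = flipIdx r a x then 1 else 0

/-- The complex orthogonal Lie algebra `so_N` of the symmetric form `J_N`. -/
noncomputable def soAlg (r : ℕ) (a : ℕ → ℕ) :
    LieSubalgebra ℂ (Matrix (Idx r a) (Idx r a) ℂ) :=
  skewAdjointMatricesLieSubalgebra (skewDiagForm r a)

/-- The standard parabolic subalgebra `p` of `so_N`: block upper triangular matrices. -/
def parabolic (r : ℕ) (a : ℕ → ℕ) : Set (Matrix (Idx r a) (Idx r a) ℂ) :=
  {A | A ∈ soAlg r a ∧ ∀ x y, A x y ≠ 0 → x.1.val ≤ y.1.val}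

/-- The nilradical `n` of `p`: strictly block upper triangular matrices in `so_N`. -/
def nilRad (r : ℕ) (a : ℕ → ℕ) : Set (Matrix (Idx r a) (Idx r a) ℂ) :=
  {A | A ∈ soAlg r a ∧ ∀ x y, A x y ≠ 0 → x.1.val < y.1.val}

/-- The first graded part `g_1`: the matrices in `so_N` supported in the blocks of the
first block super-diagonal. -/
def gradeOne (r : ℕ) (a : ℕ → ℕ) : Set (Matrix (Idx r a) (Idx r a) ℂ) :=
  {A | A ∈ soAlg r a ∧ ∀ x y, A x y ≠ 0 → y.1.val = x.1.val + 1}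

/-- `X` is a Richardson element for `p`: `X ∈ n` and `[p, X] = n`. -/
def IsRichardson (r : ℕ) (a : ℕ → ℕ) (X : Matrix (Idx r a) (Idx r a) ℂ) : Prop :=
  X ∈ nilRad r a ∧ (fun Y => ⁅Y, X⁆) '' parabolic r a = nilRad r a

/-- `p` is nice: `g_1` contains a Richardson element for `p`. -/
def IsNice (r : ℕ) (a : ℕ → ℕ) : Prop :=
  ∃ X ∈ gradeOne r a, IsRichardson r a X

/-- The sequence `(a 1, …, a r, a (r+1), a r, …, a 1)` is unimodal: it increases (weakly)
up to some place and decreases (weakly) from there on. -/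
def IsUnimodal (r : ℕ) (a : ℕ → ℕ) : Prop :=
  ∃ m : Fin (2 * r + 1),
    MonotoneOn (blockLen r a) (Set.Iic m) ∧ AntitoneOn (blockLen r a) (Set.Ici m)

/-- The `m × n`-matrix with the skew-diagonal matrix `J_s` in its upper right corner, the
skew-diagonal matrix `J_t` in its lower left corner, and zeros elsewhere. -/
def cornerBlock (m n s t : ℕ) : Matrix (Fin m) (Fin n) ℂ :=
  fun p q => if (p.val < s ∧ p.val + q.val + 1 = n) ∨ (q.val < t ∧ p.val + q.val + 1 = m)
    then 1 else 0

/-- The `m × n`-matrix `(0  J_m  0)` with `(n - m) / 2` zero columns on either side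
(for `m ≤ n` of the same parity). -/
def centerBlock (m n : ℕ) : Matrix (Fin m) (Fin n) ℂ :=
  fun p q => if p.val + q.val + 1 = m + (n - m) / 2 then 1 else 0

/-- The blocks `X_i` of the normal form `X_R` (of size `a i × a (i+1)`, for `1 ≤ i ≤ r`);
here `B_i = ⌈a_i / 2⌉ = (a i + 1) / 2`. -/
noncomputable def recipeBlock (a : ℕ → ℕ) (i : ℕ) : Matrix (Fin (a i)) (Fin (a (i + 1))) ℂ :=
  open Classical in
  if (Odd (a i) ↔ Odd (a (i + 1))) then centerBlock (a i) (a (i + 1))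
  else if a i = a (i + 1) + 1 ∧ Even (a i) then
    if Odd i then cornerBlock (a i) (a (i + 1)) ((a i + 1) / 2 - 1) ((a i + 1) / 2)
    else cornerBlock (a i) (a (i + 1)) ((a i + 1) / 2) ((a i + 1) / 2 - 1)
  else cornerBlock (a i) (a (i + 1)) ((a i + 1) / 2) ((a i + 1) / 2)

/-- The sparser blocks used for non-unimodal sequences of block lengths; here
`b_i = ⌊a_i / 2⌋ = a i / 2` and `B_i = ⌈a_i / 2⌉ = (a i + 1) / 2`. -/
noncomputable def sparseBlock (a : ℕ → ℕ) (i : ℕ) : Matrix (Fin (a i)) (Fin (a (i + 1))) ℂ :=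
  open Classical in
  if Odd i then cornerBlock (a i) (a (i + 1)) (a i / 2) ((a i + 1) / 2)
  else cornerBlock (a i) (a (i + 1)) ((a i + 1) / 2) (a i / 2)

/-- The matrix whose blocks in positions `(1,2), …, (r,r+1)` (blocks counted from `1`) are
`M 1, …, M r` and which is zero elsewhere. -/
def upperHalf (r : ℕ) (a : ℕ → ℕ) (M : ∀ i : ℕ, Matrix (Fin (a i)) (Fin (a (i + 1))) ℂ) :
    Matrix (Idx r a) (Idx r a) ℂ :=
  fun x y =>
    if h : x.1.val < r ∧ y.1.val = x.1.val + 1 then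
      M (x.1.val + 1) (Fin.cast (blockLen_left r a x.1 h.1) x.2)
        (Fin.cast (blockLen_next r a x.1 y.1 h.1 h.2) y.2)
    else 0

/-- The element of `g_1` with blocks `X_1 = M 1, …, X_r = M r` in the upper left half of the
block super-diagonal, followed by `Y_r, …, Y_1`, where `Y_i` is the negative of the
skew-transpose of `X_i`. -/
noncomputable def ofBlocks (r : ℕ) (a : ℕ → ℕ)
    (M : ∀ i : ℕ, Matrix (Fin (a i)) (Fin (a (i + 1))) ℂ) : Matrix (Idx r a) (Idx r a) ℂ :=
  fun x y => upperHalf r a M x y - upperHalf r a M (flipIdx r a y) (flipIdx r a x)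

/-- The normal form `X_R`. -/
noncomputable def normalForm (r : ℕ) (a : ℕ → ℕ) : Matrix (Idx r a) (Idx r a) ℂ :=
  ofBlocks r a (recipeBlock a)

/-- The matrix obtained from `X_R` by replacing `X_i` by `Z`, and `Y_i` by the negative of
the skew-transpose of `Z`. -/
noncomputable def normalFormReplaced (r : ℕ) (a : ℕ → ℕ) (i : ℕ)
    (Z : Matrix (Fin (a i)) (Fin (a (i + 1))) ℂ) : Matrix (Idx r a) (Idx r a) ℂ :=
  ofBlocks r a (Function.update (recipeBlock a) i Z)

/-- `Z` has rank `a i` and exactly `a i` nonzero entries. -/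
def IsSparse (a : ℕ → ℕ) (i : ℕ) (Z : Matrix (Fin (a i)) (Fin (a (i + 1))) ℂ) : Prop :=
  Z.rank = a i ∧ {pq : Fin (a i) × Fin (a (i + 1)) | Z pq.1 pq.2 ≠ 0}.ncard = a i

/-- `Z` is an admissible choice of the replacement block for `X_i`: any matrix of rank `a i`
with exactly `a i` nonzero entries if the block lengths are unimodal, and the explicit matrix
`sparseBlock a i` otherwise. -/
def IsReplacement (r : ℕ) (a : ℕ → ℕ) (i : ℕ)
    (Z : Matrix (Fin (a i)) (Fin (a (i + 1))) ℂ) : Prop :=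
  (IsUnimodal r a → IsSparse a i Z) ∧ (¬ IsUnimodal r a → Z = sparseBlock a i)

section

open Matrix ComplexOrder

/-! For `X` in `gradeOne`, being Richardson is equivalent to having no nonzero strictly block lower
triangular element of `soAlg` commuting with `X`, by duality under the trace form
(`not_isRichardson_of_commute`, `isRichardson_of_forall_commute`). Commuting elements can be written
down from two kernel vectors of `X` (`not_isRichardson_of_pair`) or from an `X`-string of suitable
parity (`not_isRichardson_of_chain`).

These obstructions have two consequences. First, niceness forces a rigid shape on a non-unimodal
sequence: a single descent `a l = a (l+1) + 1`, constant afterwards, weakly increasing before, with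
`a (l-1) ≤ a (l+1)` if `2 ≤ l` (`IsRichardson.hasDescentAt`). Second, an even power of `X` carries
the mirror of block `j` to block `j` through the Gram matrix `G_j = M_j ⋯ M_r J (M_j ⋯ M_r)ᵀ`, up to
sign (`pow_mulVec_oppVec`), and a singular `G_j` with `a j ≤ a (j+1)` excludes Richardson
(`not_isRichardson_of_gram`). Conversely, if `a (l-1) = a (l+1)`, injectivity of these powers for
all `j ≠ l` suffices (`isRichardson_of_hasDescentAt`).

It remains to decide which Gram matrices are singular. The explicit blocks have nonnegative entries,
so supports of products are found without cancellation. On a weakly increasing step a recipe block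
turns an antidiagonal Gram matrix with positive entries into another one. A matrix with one nonzero
entry per row, an odd number of rows and an even number of columns cannot do so: mirroring columns
would be a fixed-point-free involution on an odd set of rows (`sparse_congr_degenerate`). This
settles the unimodal case. If the descent follows the replaced block immediately, the product of the
sparse block with the next block is the identity when `a (l-1) = a (l+1)`, and otherwise its middle
row has no mirror partner. If the descent comes later, `G_{l-1}` is either already singular or again
antidiagonal (`recipeBlock_congr_drop_dichotomy`), and in the latter case the sparse block makes its
own Gram matrix singular. -/

/-! ### The flip involution and the orthogonal Lie algebra -/

theorem flipIdx_flipIdx {r : ℕ} {a : ℕ → ℕ} (x : Idx r a) : flipIdx r a (flipIdx r a x) = x := by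
  obtain ⟨k, p⟩ := x
  have hk : k.rev.rev = k := Fin.rev_rev k
  refine Sigma.ext hk ?_
  rw [Fin.heq_ext_iff (by simp [flipIdx])]
  have := blockLen_rev r a k
  have := p.isLt
  simp only [flipIdx, Fin.val_cast, Fin.val_rev]
  omega

theorem flipIdx_fst {r : ℕ} {a : ℕ → ℕ} (x : Idx r a) :
    (flipIdx r a x).1.val = 2 * r - x.1.val := by
  simp only [flipIdx, Fin.val_rev]
  omega

theorem sum_flipIdx {r : ℕ} {a : ℕ → ℕ} (f : Idx r a → ℂ) :
    ∑ x, f (flipIdx r a x) = ∑ x, f x :=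
  Function.Bijective.sum_comp (Function.Involutive.bijective flipIdx_flipIdx) f

/-- Entrywise form of `Aᵀ J = -J A`: multiplying by `J` only relabels indices by the flip. -/
theorem mem_soAlg {r : ℕ} {a : ℕ → ℕ} {A : Matrix (Idx r a) (Idx r a) ℂ} :
    A ∈ soAlg r a ↔ ∀ x y, A (flipIdx r a y) (flipIdx r a x) = -A x y := by
  have h : A ∈ soAlg r a ↔ Aᵀ * skewDiagForm r a = skewDiagForm r a * (-A) := by
    unfold soAlg
    rw [← LieSubalgebra.mem_toSubmodule]
    exact mem_skewAdjointMatricesSubmodule _ _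
  have h1 : ∀ x y, (Aᵀ * skewDiagForm r a) x y = A (flipIdx r a y) x := by
    intro x y
    rw [Matrix.mul_apply, Finset.sum_eq_single (flipIdx r a y)]
    · simp [skewDiagForm, flipIdx_flipIdx]
    · intro z _ hz
      rw [skewDiagForm, if_neg, mul_zero]
      rintro rfl
      exact hz (flipIdx_flipIdx z).symm
    · simp
  have h2 : ∀ x y, (skewDiagForm r a * (-A)) x y = -A (flipIdx r a x) y := by
    intro x y
    rw [Matrix.mul_apply, Finset.sum_eq_single (flipIdx r a x)]
    · simp [skewDiagForm]
    · intro z _ hz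
      rw [skewDiagForm, if_neg hz, zero_mul]
    · simp
  rw [h]
  constructor
  · intro e x y
    have := congrFun (congrFun e (flipIdx r a x)) y
    rw [h1, h2, flipIdx_flipIdx] at this
    exact this
  · intro e
    ext x y
    rw [h1, h2]
    have := e (flipIdx r a x) y
    rwa [flipIdx_flipIdx] at this

theorem conjTranspose_mem_soAlg {r : ℕ} {a : ℕ → ℕ} {A : Matrix (Idx r a) (Idx r a) ℂ}
    (h : A ∈ soAlg r a) : Aᴴ ∈ soAlg r a := by
  rw [mem_soAlg] at h ⊢
  intro x y
  simp only [conjTranspose_apply, h y x, star_neg]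

theorem bracket_mem_soAlg {r : ℕ} {a : ℕ → ℕ} {A B : Matrix (Idx r a) (Idx r a) ℂ}
    (hA : A ∈ soAlg r a) (hB : B ∈ soAlg r a) : A * B - B * A ∈ soAlg r a :=
  (soAlg r a).lie_mem hA hB

/-! ### Richardson elements and the negative part of the centralizer -/

/-- The strictly block upper triangular matrices of `so_N` as a subspace. -/
def nilRadSubmodule (r : ℕ) (a : ℕ → ℕ) : Submodule ℂ (Matrix (Idx r a) (Idx r a) ℂ) where
  carrier := nilRad r a
  zero_mem' := ⟨(soAlg r a).zero_mem, fun x y h => absurd rfl h⟩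
  add_mem' := by
    rintro A B ⟨hA, hA'⟩ ⟨hB, hB'⟩
    refine ⟨(soAlg r a).add_mem hA hB, fun x y h => ?_⟩
    by_contra hxy
    apply h
    rw [Matrix.add_apply, not_not.1 (mt (hA' x y) hxy), not_not.1 (mt (hB' x y) hxy), add_zero]
  smul_mem' := by
    rintro c A ⟨hA, hA'⟩
    refine ⟨(soAlg r a).smul_mem c hA, fun x y h => hA' x y fun h0 => h ?_⟩
    rw [Matrix.smul_apply, h0, smul_zero]

theorem gradeOne_subset_nilRad {r : ℕ} {a : ℕ → ℕ} {X : Matrix (Idx r a) (Idx r a) ℂ}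
    (hX : X ∈ gradeOne r a) : X ∈ nilRad r a :=
  ⟨hX.1, fun x y h => by have := hX.2 x y h; omega⟩

theorem exists_ne_zero_of_mul_apply_ne_zero {ι R : Type*} [Fintype ι] [Semiring R]
    {A B : Matrix ι ι R} {x y : ι} (h : (A * B) x y ≠ 0) : ∃ z, A x z ≠ 0 ∧ B z y ≠ 0 := by
  rw [Matrix.mul_apply] at h
  obtain ⟨z, -, hz⟩ := Finset.exists_ne_zero_of_sum_ne_zero h
  exact ⟨z, left_ne_zero_of_mul hz, right_ne_zero_of_mul hz⟩

theorem bracket_mem_nilRad {r : ℕ} {a : ℕ → ℕ} {Y X : Matrix (Idx r a) (Idx r a) ℂ}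
    (hY : Y ∈ parabolic r a) (hX : X ∈ nilRad r a) : Y * X - X * Y ∈ nilRad r a := by
  refine ⟨bracket_mem_soAlg hY.1 hX.1, fun x y h => ?_⟩
  rw [Matrix.sub_apply] at h
  by_cases h1 : (Y * X) x y = 0
  · have h2 : (X * Y) x y ≠ 0 := fun h2 => h (by rw [h1, h2, sub_zero])
    obtain ⟨z, hz, hz'⟩ := exists_ne_zero_of_mul_apply_ne_zero h2
    have := hX.2 _ _ hz
    have := hY.2 _ _ hz'
    omega
  · obtain ⟨z, hz, hz'⟩ := exists_ne_zero_of_mul_apply_ne_zero h1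
    have := hY.2 _ _ hz
    have := hX.2 _ _ hz'
    omega

/-- Invariance of the trace form gives `tr (Z [Y, X]) = 0` for every `Y`, whereas `Zᴴ` lies in the
nilradical and `tr (Z Zᴴ) ≠ 0`. Hence `Zᴴ` is not in `[p, X]`. -/
theorem not_isRichardson_of_commute {r : ℕ} {a : ℕ → ℕ} {X Z : Matrix (Idx r a) (Idx r a) ℂ}
    (hZ : Z ∈ soAlg r a) (hlow : ∀ x y, Z x y ≠ 0 → y.1.val < x.1.val) (hcomm : X * Z = Z * X)
    (h0 : Z ≠ 0) : ¬ IsRichardson r a X := by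
  rintro ⟨-, hX⟩
  have hW : Zᴴ ∈ nilRad r a := by
    refine ⟨conjTranspose_mem_soAlg hZ, fun x y h => hlow y x fun h' => h ?_⟩
    rw [conjTranspose_apply, h', star_zero]
  rw [← hX] at hW
  obtain ⟨Y, -, hY⟩ := hW
  apply h0
  rw [← trace_mul_conjTranspose_self_eq_zero_iff, ← hY]
  simp only [LieRing.of_associative_ring_bracket]
  rw [mul_sub, trace_sub, ← Matrix.mul_assoc, ← Matrix.mul_assoc, trace_mul_cycle, hcomm, sub_self]

/-- The map `W ↦ [[W, Xᴴ], X]` on the nilradical is shown to be injective, hence surjective. Since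
`Xᴴ` lowers the degree by exactly one, `[W, Xᴴ]` lands in the parabolic; this is where degree one of
`X` is needed. -/
theorem isRichardson_of_forall_commute {r : ℕ} {a : ℕ → ℕ} {X : Matrix (Idx r a) (Idx r a) ℂ}
    (hX : X ∈ gradeOne r a)
    (h : ∀ Z ∈ soAlg r a, (∀ x y, Z x y ≠ 0 → y.1.val < x.1.val) → X * Z = Z * X → Z = 0) :
    IsRichardson r a X := by
  have hpar : ∀ W ∈ nilRad r a, W * Xᴴ - Xᴴ * W ∈ parabolic r a := by
    intro W hW
    refine ⟨bracket_mem_soAlg hW.1 (conjTranspose_mem_soAlg hX.1), fun x y h => ?_⟩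
    rw [Matrix.sub_apply] at h
    have hX' : ∀ x y, Xᴴ x y ≠ 0 → x.1.val = y.1.val + 1 := fun x y h =>
      hX.2 y x fun h' => h (by rw [conjTranspose_apply, h', star_zero])
    by_cases h1 : (W * Xᴴ) x y = 0
    · have h2 : (Xᴴ * W) x y ≠ 0 := fun h2 => h (by rw [h1, h2, sub_zero])
      obtain ⟨z, hz, hz'⟩ := exists_ne_zero_of_mul_apply_ne_zero h2
      have := hX' _ _ hz
      have := hW.2 _ _ hz'
      omega
    · obtain ⟨z, hz, hz'⟩ := exists_ne_zero_of_mul_apply_ne_zero h1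
      have := hX' _ _ hz'
      have := hW.2 _ _ hz
      omega
  let L : nilRadSubmodule r a →ₗ[ℂ] nilRadSubmodule r a :=
    { toFun := fun W => ⟨(W.1 * Xᴴ - Xᴴ * W.1) * X - X * (W.1 * Xᴴ - Xᴴ * W.1),
        bracket_mem_nilRad (hpar W.1 W.2) (gradeOne_subset_nilRad hX)⟩
      map_add' := by
        intro A B
        ext1
        simp only [Submodule.coe_add]
        noncomm_ring
      map_smul' := by
        intro c A
        ext1
        simp [smul_sub, sub_mul, mul_sub] }
  have hL : Function.Injective L := by
    rw [← LinearMap.ker_eq_bot, LinearMap.ker_eq_bot']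
    intro W hW
    have e : (W.1 * Xᴴ - Xᴴ * W.1) * X - X * (W.1 * Xᴴ - Xᴴ * W.1) = 0 := congrArg Subtype.val hW
    set Y := W.1 * Xᴴ - Xᴴ * W.1 with hYdef
    have hYH : Yᴴ = X * W.1ᴴ - W.1ᴴ * X := by
      rw [hYdef, conjTranspose_sub, conjTranspose_mul, conjTranspose_mul,
        conjTranspose_conjTranspose]
    -- Adjointness: `tr (Yᴴ Y)` equals, up to cyclic permutation, the trace of `Wᴴ [Y, X]`, which is
    -- zero.
    have hY : Y = 0 := by
      rw [← trace_conjTranspose_mul_self_eq_zero_iff, hYH, sub_mul, trace_sub]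
      have := congrArg (fun A => trace (W.1ᴴ * A)) e
      simp only [mul_sub, trace_sub, mul_zero, trace_zero] at this
      rw [← Matrix.mul_assoc, ← Matrix.mul_assoc, trace_mul_cycle] at this
      exact this
    rw [hY, conjTranspose_zero] at hYH
    have hW0 := h W.1ᴴ (conjTranspose_mem_soAlg W.2.1)
      (fun x y hxy => W.2.2 y x fun h' => hxy (by rw [conjTranspose_apply, h', star_zero]))
      (sub_eq_zero.1 hYH.symm)
    ext1
    exact conjTranspose_eq_zero.1 hW0
  refine ⟨gradeOne_subset_nilRad hX, Set.Subset.antisymm ?_ ?_⟩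
  · rintro _ ⟨Y, hY, rfl⟩
    exact bracket_mem_nilRad hY (gradeOne_subset_nilRad hX)
  · intro W hW
    obtain ⟨W', hW'⟩ := LinearMap.injective_iff_surjective.1 hL ⟨W, hW⟩
    exact ⟨_, hpar W'.1 W'.2, congrArg Subtype.val hW'⟩

/-! ### Graded pieces and explicit commuting elements -/

/-- The vectors supported in the `k`-th block. -/
def blockSpace (r : ℕ) (a : ℕ → ℕ) (k : ℕ) : Submodule ℂ (Idx r a → ℂ) where
  carrier := {v | ∀ x, v x ≠ 0 → x.1.val = k}
  zero_mem' := fun x h => absurd rfl h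
  add_mem' := by
    intro u v hu hv x h
    by_contra hx
    apply h
    rw [Pi.add_apply, not_not.1 (mt (hu x) hx), not_not.1 (mt (hv x) hx), add_zero]
  smul_mem' := by
    intro c v hv x h
    exact hv x fun h0 => h (by rw [Pi.smul_apply, h0, smul_zero])

theorem eq_zero_of_mem_blockSpace {r : ℕ} {a : ℕ → ℕ} {k : ℕ} {v : Idx r a → ℂ}
    (hv : v ∈ blockSpace r a k) {x : Idx r a} (h : x.1.val ≠ k) : v x = 0 :=
  not_not.1 (mt (hv x) h)

theorem mem_blockSpace_of_lt {r : ℕ} {a : ℕ → ℕ} {k : ℕ} (hk : 2 * r < k) {v : Idx r a → ℂ}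
    (hv : v ∈ blockSpace r a k) : v = 0 := by
  funext x
  refine eq_zero_of_mem_blockSpace hv ?_
  have := x.1.isLt
  omega

theorem mulVec_mem_blockSpace {r : ℕ} {a : ℕ → ℕ} {X : Matrix (Idx r a) (Idx r a) ℂ}
    (hX : X ∈ gradeOne r a) {k : ℕ} {v : Idx r a → ℂ} (hv : v ∈ blockSpace r a (k + 1)) :
    X *ᵥ v ∈ blockSpace r a k := by
  intro x hx
  obtain ⟨y, -, hy⟩ := Finset.exists_ne_zero_of_sum_ne_zero hx
  have := hX.2 x y (left_ne_zero_of_mul hy)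
  have := hv y (right_ne_zero_of_mul hy)
  omega

theorem pow_mulVec_mem_blockSpace {r : ℕ} {a : ℕ → ℕ} {X : Matrix (Idx r a) (Idx r a) ℂ}
    (hX : X ∈ gradeOne r a) {k : ℕ} (s : ℕ) {v : Idx r a → ℂ}
    (hv : v ∈ blockSpace r a (k + s)) : X ^ s *ᵥ v ∈ blockSpace r a k := by
  induction s generalizing v with
  | zero => simpa using hv
  | succ s ih =>
    rw [pow_succ, ← mulVec_mulVec]
    exact ih (mulVec_mem_blockSpace hX hv)

theorem pow_mulVec_add_eq {r : ℕ} {a : ℕ → ℕ} {X : Matrix (Idx r a) (Idx r a) ℂ}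
    (hX : X ∈ gradeOne r a) {q : ℕ} {v : Idx r a → ℂ} (hv : v ∈ blockSpace r a q) (t : ℕ)
    (x : Idx r a) (hx : (X ^ t *ᵥ v) x ≠ 0) : x.1.val + t = q := by
  induction t generalizing x with
  | zero => simpa using hv x (by simpa using hx)
  | succ t ih =>
    rw [pow_succ', ← mulVec_mulVec] at hx
    obtain ⟨y, -, hy⟩ := Finset.exists_ne_zero_of_sum_ne_zero hx
    have := hX.2 x y (left_ne_zero_of_mul hy)
    have := ih y (right_ne_zero_of_mul hy)
    omega

/-- The operator `v ↦ ⟨w, v⟩ u` for the symmetric form `J_N`. -/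
def outer {r : ℕ} {a : ℕ → ℕ} (u w : Idx r a → ℂ) : Matrix (Idx r a) (Idx r a) ℂ :=
  fun x y => u x * w (flipIdx r a y)

theorem mul_outer {r : ℕ} {a : ℕ → ℕ} (X : Matrix (Idx r a) (Idx r a) ℂ) (u w : Idx r a → ℂ) :
    X * outer u w = outer (X *ᵥ u) w := by
  ext x y
  simp only [Matrix.mul_apply, outer, mulVec, dotProduct, Finset.sum_mul, mul_assoc]

theorem outer_mul {r : ℕ} {a : ℕ → ℕ} {X : Matrix (Idx r a) (Idx r a) ℂ} (hX : X ∈ soAlg r a)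
    (u w : Idx r a → ℂ) : outer u w * X = -outer u (X *ᵥ w) := by
  rw [mem_soAlg] at hX
  ext x y
  simp only [Matrix.mul_apply, outer, mulVec, dotProduct, Matrix.neg_apply, mul_assoc]
  rw [← Finset.mul_sum, ← mul_neg, ← Finset.sum_neg_distrib,
    ← sum_flipIdx fun z => -(X (flipIdx r a y) z * w z)]
  congr 1
  refine Finset.sum_congr rfl fun z _ => ?_
  rw [hX z y]
  ring

theorem outer_flip {r : ℕ} {a : ℕ → ℕ} (u w : Idx r a → ℂ) (x y : Idx r a) :
    outer u w (flipIdx r a y) (flipIdx r a x) = outer w u x y := by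
  simp only [outer, flipIdx_flipIdx, mul_comm]

/-- The skew operator `u ∧ w` commutes with `X` because both products vanish. It sends block `2r -
q` to block `p` and block `2r - p` to block `q`, so it is strictly lower exactly because `p + q >
2r`. -/
theorem not_isRichardson_of_pair {r : ℕ} {a : ℕ → ℕ} {X : Matrix (Idx r a) (Idx r a) ℂ}
    (hX : X ∈ gradeOne r a) {p q : ℕ} (hpq : 2 * r < p + q) {u w : Idx r a → ℂ}
    (hu : u ∈ blockSpace r a p) (hw : w ∈ blockSpace r a q) (hXu : X *ᵥ u = 0)
    (hXw : X *ᵥ w = 0) (h : ∃ x y, u x * w y ≠ w x * u y) : ¬ IsRichardson r a X := by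
  refine not_isRichardson_of_commute (Z := outer u w - outer w u) ?_ ?_ ?_ ?_
  · rw [mem_soAlg]
    intro x y
    simp only [Matrix.sub_apply, outer_flip, neg_sub]
  · intro x y hxy
    have key : ∀ {p q : ℕ} {u w : Idx r a → ℂ}, u ∈ blockSpace r a p → w ∈ blockSpace r a q →
        2 * r < p + q → outer u w x y ≠ 0 → y.1.val < x.1.val := by
      intro p q u w hu hw hpq h
      have h1 := hu _ (left_ne_zero_of_mul h)
      have h2 := hw _ (right_ne_zero_of_mul h)
      rw [flipIdx_fst] at h2
      omega
    by_cases h1 : outer u w x y = 0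
    · refine key hw hu (by omega) fun h2 => hxy ?_
      rw [Matrix.sub_apply, h1, h2, sub_zero]
    · exact key hu hw hpq h1
  · rw [mul_sub, sub_mul, mul_outer, mul_outer, outer_mul hX.1, outer_mul hX.1, hXu, hXw]
    ext x y
    simp [outer]
  · obtain ⟨x, y, h⟩ := h
    intro h0
    have := congrFun (congrFun h0 x) (flipIdx r a y)
    simp only [Matrix.sub_apply, outer, flipIdx_flipIdx, Matrix.zero_apply] at this
    exact h (sub_eq_zero.1 this)

theorem not_isRichardson_of_pair_of_ne {r : ℕ} {a : ℕ → ℕ} {X : Matrix (Idx r a) (Idx r a) ℂ}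
    (hX : X ∈ gradeOne r a) {p q : ℕ} (hpq : 2 * r < p + q) (hne : p ≠ q) {u w : Idx r a → ℂ}
    (hu : u ∈ blockSpace r a p) (hw : w ∈ blockSpace r a q) (hXu : X *ᵥ u = 0)
    (hXw : X *ᵥ w = 0) (hu0 : u ≠ 0) (hw0 : w ≠ 0) : ¬ IsRichardson r a X := by
  obtain ⟨x, hx⟩ := Function.ne_iff.1 hu0
  obtain ⟨y, hy⟩ := Function.ne_iff.1 hw0
  refine not_isRichardson_of_pair hX hpq hu hw hXu hXw ⟨x, y, ?_⟩
  rw [eq_zero_of_mem_blockSpace hw (x := x) (by rw [hu x hx]; exact hne), zero_mul]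
  exact mul_ne_zero hx hy

/-- The alternating sum of the operators built from `X^t v` and `X^(s-t) v` telescopes under the
commutator with `X`. Exchanging `t` and `s - t` changes the sign because `s` is odd, which makes the
sum skew. The block indices of each pair add up to `2q - s > 2r`, so it is strictly lower. -/
theorem not_isRichardson_of_chain {r : ℕ} {a : ℕ → ℕ} {X : Matrix (Idx r a) (Idx r a) ℂ}
    (hX : X ∈ gradeOne r a) {q s : ℕ} (hs : Odd s) (hqs : 2 * r + s < 2 * q) {v : Idx r a → ℂ}
    (hv : v ∈ blockSpace r a q) (h1 : X ^ (s + 1) *ᵥ v = 0) (h0 : X ^ s *ᵥ v ≠ 0) :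
    ¬ IsRichardson r a X := by
  have hdeg := pow_mulVec_add_eq hX hv
  refine not_isRichardson_of_commute (Z := ∑ t ∈ Finset.range (s + 1),
    (-1 : ℂ) ^ t • outer (X ^ t *ᵥ v) (X ^ (s - t) *ᵥ v)) ?_ ?_ ?_ ?_
  · rw [mem_soAlg]
    intro x y
    rw [Matrix.sum_apply, Matrix.sum_apply, ← Finset.sum_range_reflect, ← Finset.sum_neg_distrib]
    refine Finset.sum_congr rfl fun t ht => ?_
    rw [Finset.mem_range] at ht
    have e : s + 1 - 1 - t = s - t := by omega
    have e' : s - (s - t) = t := by omega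
    have sg : (-1 : ℂ) ^ (s - t) = -(-1) ^ t := by
      have h : (-1 : ℂ) ^ (s - t) * (-1) ^ t = -1 := by
        rw [← pow_add, Nat.sub_add_cancel (by omega), hs.neg_one_pow]
      have h2 : (-1 : ℂ) ^ t * (-1) ^ t = 1 := by
        rw [← mul_pow]; simp
      linear_combination (-1 : ℂ) ^ t * h - (-1 : ℂ) ^ (s - t) * h2
    rw [e, e', Matrix.smul_apply, Matrix.smul_apply, outer_flip, sg, neg_smul]
  · intro x y hxy
    rw [Matrix.sum_apply] at hxy
    obtain ⟨t, ht, h⟩ := Finset.exists_ne_zero_of_sum_ne_zero hxy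
    rw [Finset.mem_range] at ht
    have h' : outer (X ^ t *ᵥ v) (X ^ (s - t) *ᵥ v) x y ≠ 0 := right_ne_zero_of_mul h
    have e1 := hdeg _ _ (left_ne_zero_of_mul h')
    have e2 := hdeg _ _ (right_ne_zero_of_mul h')
    rw [flipIdx_fst] at e2
    omega
  · rw [← sub_eq_zero, Finset.mul_sum, Finset.sum_mul, ← Finset.sum_sub_distrib]
    -- Each commutator is a difference of consecutive terms; only the two end terms survive, and
    -- both contain `X ^ (s + 1) *ᵥ v = 0`.
    have : ∀ t ∈ Finset.range (s + 1),
        X * (-1 : ℂ) ^ t • outer (X ^ t *ᵥ v) (X ^ (s - t) *ᵥ v) -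
          ((-1 : ℂ) ^ t • outer (X ^ t *ᵥ v) (X ^ (s - t) *ᵥ v)) * X =
        (-1 : ℂ) ^ t • outer (X ^ t *ᵥ v) (X ^ (s + 1 - t) *ᵥ v) -
          (-1 : ℂ) ^ (t + 1) • outer (X ^ (t + 1) *ᵥ v) (X ^ (s + 1 - (t + 1)) *ᵥ v) := by
      intro t ht
      rw [Finset.mem_range] at ht
      have e : s + 1 - t = (s - t) + 1 := by omega
      rw [mul_smul_comm, smul_mul_assoc, mul_outer, outer_mul hX.1, mulVec_mulVec, mulVec_mulVec,
        ← pow_succ', ← pow_succ', Nat.add_sub_add_right, e, pow_succ (-1 : ℂ) t]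
      module
    rw [Finset.sum_congr rfl this, Finset.sum_range_sub']
    simp only [Nat.sub_zero, h1, Nat.sub_self]
    ext x y
    simp [outer]
  · obtain ⟨x, hx⟩ : ∃ x, v x ≠ 0 := by
      by_contra! h
      exact h0 (by rw [show v = 0 from funext h, mulVec_zero])
    obtain ⟨y, hy⟩ := Function.ne_iff.1 h0
    intro hZ
    have := congrFun (congrFun hZ x) (flipIdx r a y)
    -- The row `x` lies in block `q`, where `X^t v` vanishes for `t > 0`.
    rw [Matrix.sum_apply, Finset.sum_eq_single 0] at this
    · simp only [pow_zero, one_smul, one_mulVec, Nat.sub_zero, outer, flipIdx_flipIdx] at this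
      exact mul_ne_zero hx hy this
    · intro t _ ht
      have : (X ^ t *ᵥ v) x = 0 := by
        by_contra h
        have := hdeg _ _ h
        have := hv x hx
        omega
      rw [Matrix.smul_apply, outer, this, zero_mul, smul_zero]
    · simp

theorem finrank_blockSpace {r : ℕ} {a : ℕ → ℕ} {k : ℕ} (hk : k < 2 * r + 1) :
    Module.finrank ℂ (blockSpace r a k) = a (min (k + 1) (2 * r + 1 - k)) := by
  let e : blockSpace r a k ≃ₗ[ℂ] (Fin (blockLen r a ⟨k, hk⟩) → ℂ) :=
    { toFun := fun v p => v.1 ⟨⟨k, hk⟩, p⟩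
      map_add' := fun _ _ => rfl
      map_smul' := fun _ _ => rfl
      invFun := fun w => ⟨fun x => if h : x.1 = ⟨k, hk⟩ then w (Fin.cast (by rw [h]) x.2) else 0,
        fun x hx => by
          by_contra h
          refine hx (dif_neg fun h' => h ?_)
          rw [h']⟩
      left_inv := by
        intro v
        ext ⟨k', p⟩
        by_cases h : k' = ⟨k, hk⟩
        · subst h
          simp
        · simp only [h, dite_false]
          exact (eq_zero_of_mem_blockSpace v.2 fun h' => h (Fin.ext h')).symm
      right_inv := by
        intro w
        ext p
        simp }
  rw [e.finrank_eq, Module.finrank_fin_fun]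
  rfl

theorem finrank_blockSpace_left {r : ℕ} {a : ℕ → ℕ} {j : ℕ} (hj : j ≤ r) :
    Module.finrank ℂ (blockSpace r a j) = a (j + 1) := by
  rw [finrank_blockSpace (by omega)]
  congr 1
  omega

theorem finrank_blockSpace_right {r : ℕ} {a : ℕ → ℕ} {k : ℕ} (hk : r ≤ k) (hk' : k ≤ 2 * r) :
    Module.finrank ℂ (blockSpace r a k) = a (2 * r + 1 - k) := by
  rw [finrank_blockSpace (by omega)]
  congr 1
  omega

theorem exists_pow_mulVec_eq_zero {r : ℕ} {a : ℕ → ℕ} {X : Matrix (Idx r a) (Idx r a) ℂ}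
    (hX : X ∈ gradeOne r a) {k s : ℕ}
    (h : Module.finrank ℂ (blockSpace r a k) < Module.finrank ℂ (blockSpace r a (k + s))) :
    ∃ v ∈ blockSpace r a (k + s), v ≠ 0 ∧ X ^ s *ᵥ v = 0 := by
  let f : blockSpace r a (k + s) →ₗ[ℂ] blockSpace r a k :=
    (X ^ s).mulVecLin.restrict fun v hv => pow_mulVec_mem_blockSpace hX s hv
  obtain ⟨v, hv, hv0⟩ := (Submodule.ne_bot_iff _).1 (LinearMap.ker_ne_bot_of_finrank_lt (f := f) h)
  exact ⟨v.1, v.2, fun h0 => hv0 (Subtype.ext h0), congrArg Subtype.val hv⟩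

/-- One spare dimension pays for the extra condition `v x = 0`, which makes `v` independent of a
kernel vector that is nonzero at `x`. -/
theorem exists_mulVec_eq_zero_of_apply {r : ℕ} {a : ℕ → ℕ}
    {X : Matrix (Idx r a) (Idx r a) ℂ} (hX : X ∈ gradeOne r a) {k : ℕ}
    (h : Module.finrank ℂ (blockSpace r a k) + 1 < Module.finrank ℂ (blockSpace r a (k + 1)))
    (x : Idx r a) : ∃ v ∈ blockSpace r a (k + 1), v ≠ 0 ∧ X *ᵥ v = 0 ∧ v x = 0 := by
  let f : blockSpace r a (k + 1) →ₗ[ℂ] blockSpace r a k :=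
    X.mulVecLin.restrict fun v hv => mulVec_mem_blockSpace hX hv
  let g : blockSpace r a (k + 1) →ₗ[ℂ] ℂ := (LinearMap.proj x).comp (Submodule.subtype _)
  obtain ⟨v, hv, hv0⟩ := (Submodule.ne_bot_iff _).1
    (LinearMap.ker_ne_bot_of_finrank_lt (f := f.prod g) (by simpa using h))
  have hv' : (f v, g v) = (0, 0) := hv
  rw [Prod.mk.injEq] at hv'
  exact ⟨v.1, v.2, fun h0 => hv0 (Subtype.ext h0), congrArg Subtype.val hv'.1, hv'.2⟩

/-! ### The shape forced by niceness -/

/-- The shape of the block lengths of a nice parabolic subalgebra with a descent among the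
first `r + 1` block lengths. -/
structure HasDescentAt (r : ℕ) (a : ℕ → ℕ) (l : ℕ) : Prop where
  drop : a l = a (l + 1) + 1
  const : ∀ j, l < j → j ≤ r + 1 → a j = a (l + 1)
  mono : ∀ j, 1 ≤ j → j < l → a j ≤ a (j + 1)
  le : 2 ≤ l → a (l - 1) ≤ a (l + 1)

/-- A descent at `l` produces a kernel vector `w` in the mirror of block `l`. Pairing it with any
other kernel vector sufficiently far to the right is forbidden, so `X` is injective on all those
other blocks, and comparing dimensions on both sides of the palindrome gives the inequalities. -/
theorem IsRichardson.hasDescentAt {r : ℕ} {a : ℕ → ℕ} {X : Matrix (Idx r a) (Idx r a) ℂ}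
    (hX : X ∈ gradeOne r a) (hR : IsRichardson r a X) {l : ℕ} (hl1 : 1 ≤ l) (hlr : l ≤ r)
    (hl : a (l + 1) < a l) : HasDescentAt r a l := by
  have hk1 : Module.finrank ℂ (blockSpace r a (2 * r - l)) = a (l + 1) := by
    rw [finrank_blockSpace_right (by omega) (by omega)]
    congr 1
    omega
  have hk2 : Module.finrank ℂ (blockSpace r a (2 * r - l + 1)) = a l := by
    rw [finrank_blockSpace_right (by omega) (by omega)]
    congr 1
    omega
  obtain ⟨w, hw, hw0, hXw⟩ := exists_pow_mulVec_eq_zero hX (k := 2 * r - l) (s := 1)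
    (by rwa [hk1, hk2])
  rw [pow_one] at hXw
  have inj : ∀ k, l ≤ k + 1 → k ≠ 2 * r - l → ∀ v ∈ blockSpace r a (k + 1),
      X *ᵥ v = 0 → v = 0 := by
    intro k hk hkl v hv hXv
    by_contra hv0
    exact not_isRichardson_of_pair_of_ne hX (by omega) (by omega) hv hw hXv hXw hv0 hw0 hR
  have hle : ∀ k, l ≤ k + 1 → k ≠ 2 * r - l →
      Module.finrank ℂ (blockSpace r a (k + 1)) ≤ Module.finrank ℂ (blockSpace r a k) := by
    intro k hk hkl
    by_contra! h
    obtain ⟨v, hv, hv0, hXv⟩ := exists_pow_mulVec_eq_zero hX (s := 1) h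
    exact hv0 (inj k hk hkl v hv (by rwa [pow_one] at hXv))
  have hdown : ∀ j, l ≤ j → j ≤ r → a (j + 1) ≤ a j := by
    intro j hj hjr
    have := hle (j - 1) (by omega) (by omega)
    rw [finrank_blockSpace_left (by omega), finrank_blockSpace_left (by omega)] at this
    rwa [Nat.sub_add_cancel (by omega)] at this
  have hup : ∀ j, 1 ≤ j → j ≤ r → j ≠ l → a j ≤ a (j + 1) := by
    intro j hj hjr hjl
    have := hle (2 * r - j) (by omega) (by omega)
    rw [finrank_blockSpace_right (by omega) (by omega),
      finrank_blockSpace_right (by omega) (by omega)] at this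
    rwa [show 2 * r + 1 - (2 * r - j + 1) = j by omega,
      show 2 * r + 1 - (2 * r - j) = j + 1 by omega] at this
  refine ⟨?_, ?_, fun j h1 h2 => hup j h1 (by omega) (by omega), fun hl2 => ?_⟩
  -- A drop of at least two leaves a second kernel vector in the same block, independent of `w`.
  · by_contra hne
    obtain ⟨x, hx⟩ := Function.ne_iff.1 hw0
    obtain ⟨v, hv, hv0, hXv, hvx⟩ := exists_mulVec_eq_zero_of_apply hX (k := 2 * r - l)
      (by rw [hk1, hk2]; omega) x
    obtain ⟨y, hy⟩ := Function.ne_iff.1 hv0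
    refine not_isRichardson_of_pair hX (by omega) hw hv hXw hXv ⟨x, y, ?_⟩ hR
    rw [hvx, zero_mul]
    exact mul_ne_zero hx hy
  · intro j hj hjr
    induction j, hj using Nat.le_induction with
    | base => rfl
    | succ j hj ih =>
      rw [← ih (by omega)]
      exact le_antisymm (hdown j (by omega) (by omega)) (hup j (by omega) (by omega) (by omega))
  -- If `a (l-1) > a (l+1)`, then `X²` has a kernel vector two blocks apart, on which `X` is
  -- injective: a forbidden chain with `s = 1`.
  · by_contra! h
    obtain ⟨y, hy, hy0, hXy⟩ := exists_pow_mulVec_eq_zero hX (k := 2 * r - l) (s := 2) (by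
      rw [hk1, finrank_blockSpace_right (by omega) (by omega)]
      rwa [show 2 * r + 1 - (2 * r - l + 2) = l - 1 by omega])
    by_cases hX1 : X *ᵥ y = 0
    · exact hy0 (inj (2 * r - l + 1) (by omega) (by omega) y hy hX1)
    · exact not_isRichardson_of_chain hX (s := 1) odd_one (by omega) hy hXy (by rwa [pow_one]) hR

/-! ### Unimodality and the parity of the total size -/

theorem isUnimodal_iff {r : ℕ} {a : ℕ → ℕ} :
    IsUnimodal r a ↔ ∀ j, 1 ≤ j → j ≤ r → a j ≤ a (j + 1) := by
  constructor
  · rintro ⟨m, hm1, hm2⟩ j hj hjr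
    have e1 : blockLen r a ⟨j - 1, by omega⟩ = a j := by
      unfold blockLen
      congr 1
      simp only
      omega
    have e2 : blockLen r a ⟨j, by omega⟩ = a (j + 1) := by
      unfold blockLen
      congr 1
      simp only
      omega
    have e3 : blockLen r a ⟨2 * r + 1 - j, by omega⟩ = a j := by
      unfold blockLen
      congr 1
      simp only
      omega
    -- If the peak lies to the left of this step, the mirrored entry `a j` occurs later on the
    -- decreasing side, which gives the same inequality.
    by_cases h : j ≤ m.val
    · have := hm1 (a := ⟨j - 1, by omega⟩) (b := ⟨j, by omega⟩)
        (by simp only [Set.mem_Iic, Fin.le_def]; omega)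
        (by simp only [Set.mem_Iic, Fin.le_def]; omega) (by simp only [Fin.le_def]; omega)
      rwa [e1, e2] at this
    · have := hm2 (a := ⟨j, by omega⟩) (b := ⟨2 * r + 1 - j, by omega⟩)
        (by simp only [Set.mem_Ici, Fin.le_def]; omega)
        (by simp only [Set.mem_Ici, Fin.le_def]; omega) (by simp only [Fin.le_def]; omega)
      rwa [e2, e3] at this
  · intro h
    have key : ∀ i, 1 ≤ i → ∀ j, i ≤ j → j ≤ r + 1 → a i ≤ a j := by
      intro i hi j hij hj
      induction j, hij using Nat.le_induction with
      | base => rfl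
      | succ j hj' ih => exact (ih (by omega)).trans (h j (by omega) (by omega))
    refine ⟨⟨r, by omega⟩, ?_, ?_⟩
    · intro x hx y hy hxy
      simp only [Set.mem_Iic, Fin.le_def] at hx hy hxy
      exact key _ (by omega) _ (by omega) (by omega)
    · intro x hx y hy hxy
      simp only [Set.mem_Ici, Fin.le_def] at hx hy hxy
      have := x.isLt
      have := y.isLt
      exact key _ (by omega) _ (by omega) (by omega)

theorem odd_totalSize_iff {r : ℕ} {a : ℕ → ℕ} : Odd (totalSize r a) ↔ Odd (a (r + 1)) := by
  have h1 : totalSize r a = ∑ k ∈ Finset.range (r + 1 + r), a (min (k + 1) (2 * r + 1 - k)) := by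
    rw [show r + 1 + r = 2 * r + 1 by omega]
    exact Fin.sum_univ_eq_sum_range (fun k => a (min (k + 1) (2 * r + 1 - k))) (2 * r + 1)
  have h2 : totalSize r a = 2 * ∑ k ∈ Finset.range r, a (k + 1) + a (r + 1) := by
    rw [h1, Finset.sum_range_add, Finset.sum_range_succ,
      ← Finset.sum_range_reflect (fun x => a (min (r + 1 + x + 1) (2 * r + 1 - (r + 1 + x))))]
    have e1 : ∑ k ∈ Finset.range r, a (min (k + 1) (2 * r + 1 - k)) =
        ∑ k ∈ Finset.range r, a (k + 1) := by
      refine Finset.sum_congr rfl fun k hk => ?_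
      rw [Finset.mem_range] at hk
      congr 1
      omega
    have e2 : ∑ k ∈ Finset.range r, a (min (r + 1 + (r - 1 - k) + 1)
        (2 * r + 1 - (r + 1 + (r - 1 - k)))) = ∑ k ∈ Finset.range r, a (k + 1) := by
      refine Finset.sum_congr rfl fun k hk => ?_
      rw [Finset.mem_range] at hk
      congr 1
      omega
    rw [e1, e2, show min (r + 1) (2 * r + 1 - r) = r + 1 by omega]
    ring
  rw [h2, Nat.odd_iff, Nat.odd_iff]
  omega

/-! ### Vectors in single blocks and the action of `ofBlocks` -/

/-- Extension of a finite sequence by zeros. -/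
def extendZero {n : ℕ} (v : Fin n → ℂ) (i : ℕ) : ℂ := if h : i < n then v ⟨i, h⟩ else 0

theorem extendZero_val {n : ℕ} (v : Fin n → ℂ) (i : Fin n) : extendZero v i.val = v i :=
  dif_pos i.isLt

/-- The vector with entries `v` in the block number `j` (blocks counted from `1`). -/
def blockVec (r : ℕ) (a : ℕ → ℕ) (j : ℕ) (v : Fin (a j) → ℂ) (x : Idx r a) : ℂ :=
  if x.1.val + 1 = j then extendZero v x.2.val else 0

/-- The vector with the reversed entries of `v` in the block opposite to the block number `j`. -/
def oppVec (r : ℕ) (a : ℕ → ℕ) (j : ℕ) (v : Fin (a j) → ℂ) (x : Idx r a) : ℂ :=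
  blockVec r a j v (flipIdx r a x)

theorem blockVec_mem {r : ℕ} {a : ℕ → ℕ} {j : ℕ} (v : Fin (a (j + 1)) → ℂ) :
    blockVec r a (j + 1) v ∈ blockSpace r a j := by
  intro x hx
  by_contra h
  exact hx (if_neg (by omega))

theorem oppVec_mem {r : ℕ} {a : ℕ → ℕ} {j k : ℕ} (hjk : k + j = 2 * r + 1)
    (v : Fin (a j) → ℂ) : oppVec r a j v ∈ blockSpace r a k := by
  intro x hx
  by_contra h
  refine hx (if_neg ?_)
  rw [flipIdx_fst]
  have := x.1.isLt
  omega

theorem exists_eq_blockVec {r : ℕ} {a : ℕ → ℕ} {j : ℕ} (hj : j ≤ r) {u : Idx r a → ℂ}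
    (hu : u ∈ blockSpace r a j) : ∃ v, u = blockVec r a (j + 1) v := by
  have hlen : a (j + 1) = blockLen r a ⟨j, by omega⟩ := by
    unfold blockLen
    congr 1
    simp only
    omega
  refine ⟨fun p => u ⟨⟨j, by omega⟩, Fin.cast hlen p⟩, ?_⟩
  funext ⟨k, p⟩
  by_cases h : k.val = j
  · subst h
    have hp : p.val < a (k.val + 1) := p.isLt.trans_eq hlen.symm
    simp [blockVec, extendZero, hp]
  · rw [eq_zero_of_mem_blockSpace hu h, blockVec, if_neg (by simpa using h)]

theorem exists_eq_oppVec {r : ℕ} {a : ℕ → ℕ} {j k : ℕ} (hj1 : 1 ≤ j) (hj : j ≤ r + 1)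
    (hjk : k + j = 2 * r + 1) {u : Idx r a → ℂ} (hu : u ∈ blockSpace r a k) :
    ∃ v, u = oppVec r a j v := by
  obtain ⟨j, rfl⟩ : ∃ i, j = i + 1 := ⟨j - 1, by omega⟩
  have hu' : (fun x => u (flipIdx r a x)) ∈ blockSpace r a j := by
    intro x hx
    have := hu _ hx
    rw [flipIdx_fst] at this
    have := x.1.isLt
    omega
  obtain ⟨v, hv⟩ := exists_eq_blockVec (by omega) hu'
  refine ⟨v, funext fun x => ?_⟩
  rw [oppVec, ← hv]
  simp only [flipIdx_flipIdx]

theorem blockVec_ne_zero {r : ℕ} {a : ℕ → ℕ} {j : ℕ} (hj1 : 1 ≤ j) (hj : j ≤ r + 1)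
    {v : Fin (a j) → ℂ} (hv : v ≠ 0) : blockVec r a j v ≠ 0 := by
  obtain ⟨j, rfl⟩ : ∃ i, j = i + 1 := ⟨j - 1, by omega⟩
  obtain ⟨p, hp⟩ := Function.ne_iff.1 hv
  have hlen : a (j + 1) = blockLen r a ⟨j, by omega⟩ := by
    unfold blockLen
    congr 1
    simp only
    omega
  refine Function.ne_iff.2 ⟨⟨⟨j, by omega⟩, Fin.cast hlen p⟩, ?_⟩
  simpa [blockVec, extendZero] using hp

theorem oppVec_ne_zero {r : ℕ} {a : ℕ → ℕ} {j : ℕ} (hj1 : 1 ≤ j) (hj : j ≤ r + 1)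
    {v : Fin (a j) → ℂ} (hv : v ≠ 0) : oppVec r a j v ≠ 0 := by
  obtain ⟨x, hx⟩ := Function.ne_iff.1 (blockVec_ne_zero hj1 hj hv)
  refine Function.ne_iff.2 ⟨flipIdx r a x, ?_⟩
  rwa [oppVec, flipIdx_flipIdx]

theorem sum_block {r : ℕ} {a : ℕ → ℕ} {j : ℕ} (hj : j ≤ r) (g : ℕ → ℂ) :
    ∑ y : Idx r a, (if y.1.val = j then g y.2.val else 0) = ∑ q : Fin (a (j + 1)), g q := by
  have hlen : blockLen r a ⟨j, by omega⟩ = a (j + 1) := by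
    unfold blockLen
    congr 1
    simp only
    omega
  rw [Fintype.sum_sigma, Finset.sum_eq_single ⟨j, by omega⟩]
  · simp only [if_true]
    rw [Fin.sum_univ_eq_sum_range g, Fin.sum_univ_eq_sum_range g, hlen]
  · intro k _ hk
    refine Finset.sum_eq_zero fun p _ => if_neg fun h => hk (Fin.ext h)
  · simp

theorem upperHalf_apply {r : ℕ} {a : ℕ → ℕ}
    (M : ∀ i : ℕ, Matrix (Fin (a i)) (Fin (a (i + 1))) ℂ) {x y : Idx r a}
    (h : x.1.val < r ∧ y.1.val = x.1.val + 1) : upperHalf r a M x y =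
      M (x.1.val + 1) (Fin.cast (blockLen_left r a x.1 h.1) x.2)
        (Fin.cast (blockLen_next r a x.1 y.1 h.1 h.2) y.2) :=
  dif_pos h

theorem upperHalf_apply_eq_zero {r : ℕ} {a : ℕ → ℕ}
    (M : ∀ i : ℕ, Matrix (Fin (a i)) (Fin (a (i + 1))) ℂ) {x y : Idx r a}
    (h : ¬ (x.1.val < r ∧ y.1.val = x.1.val + 1)) : upperHalf r a M x y = 0 :=
  dif_neg h

theorem ofBlocks_apply {r : ℕ} {a : ℕ → ℕ}
    (M : ∀ i : ℕ, Matrix (Fin (a i)) (Fin (a (i + 1))) ℂ) (x y : Idx r a) :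
    ofBlocks r a M x y =
      upperHalf r a M x y - upperHalf r a M (flipIdx r a y) (flipIdx r a x) :=
  rfl

theorem upperHalf_mulVec_blockVec {r : ℕ} {a : ℕ → ℕ}
    (M : ∀ i : ℕ, Matrix (Fin (a i)) (Fin (a (i + 1))) ℂ) {j : ℕ} (hj1 : 1 ≤ j) (hj : j ≤ r)
    (v : Fin (a (j + 1)) → ℂ) :
    upperHalf r a M *ᵥ blockVec r a (j + 1) v = blockVec r a j (M j *ᵥ v) := by
  funext x
  by_cases hx : x.1.val + 1 = j
  · subst hx
    have hp : x.2.val < a (x.1.val + 1) := by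
      have := blockLen_left r a x.1 (by omega)
      have := x.2.isLt
      omega
    rw [blockVec, if_pos rfl, extendZero, dif_pos hp]
    simp only [mulVec, dotProduct]
    have h := sum_block (a := a) hj
      (fun q => (if h : q < a (x.1.val + 1 + 1) then M (x.1.val + 1) ⟨x.2.val, hp⟩ ⟨q, h⟩ else 0) *
        extendZero v q)
    simp only [Fin.is_lt, dite_true, Fin.eta, extendZero_val] at h
    rw [← h]
    refine Finset.sum_congr rfl fun y _ => ?_
    by_cases hy : y.1.val = x.1.val + 1
    · have hq : y.2.val < a (x.1.val + 1 + 1) := by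
        have := blockLen_next r a x.1 y.1 (by omega) hy
        have := y.2.isLt
        omega
      rw [if_pos hy, dif_pos hq, upperHalf_apply M ⟨by omega, hy⟩, blockVec, if_pos (by omega)]
      rfl
    · rw [if_neg hy, blockVec, if_neg (by omega), mul_zero]
  · rw [blockVec, if_neg hx]
    refine Finset.sum_eq_zero fun y _ => ?_
    by_cases hy : y.1.val = x.1.val + 1
    · rw [blockVec, if_neg (by omega), mul_zero]
    · exact mul_eq_zero_of_left (upperHalf_apply_eq_zero M (fun h => hy h.2)) _

theorem blockVec_vecMul_upperHalf {r : ℕ} {a : ℕ → ℕ}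
    (M : ∀ i : ℕ, Matrix (Fin (a i)) (Fin (a (i + 1))) ℂ) {j : ℕ} (hj1 : 1 ≤ j) (hj : j ≤ r)
    (v : Fin (a j) → ℂ) :
    blockVec r a j v ᵥ* upperHalf r a M = blockVec r a (j + 1) (v ᵥ* M j) := by
  obtain ⟨j, rfl⟩ : ∃ i, j = i + 1 := ⟨j - 1, by omega⟩
  funext y
  by_cases hy : y.1.val = j + 1
  · have hq : y.2.val < a (j + 1 + 1) := by
      have := blockLen_next r a ⟨j, by omega⟩ y.1 (by simp only; omega) hy
      have := y.2.isLt
      simp only at *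
      omega
    rw [blockVec, if_pos (by omega), extendZero, dif_pos hq]
    simp only [vecMul, dotProduct]
    have h := sum_block (r := r) (a := a) (j := j) (by omega)
      (fun p => extendZero v p *
        (if h : p < a (j + 1) then M (j + 1) ⟨p, h⟩ ⟨y.2.val, hq⟩ else 0))
    simp only [Fin.is_lt, dite_true, Fin.eta, extendZero_val] at h
    rw [← h]
    refine Finset.sum_congr rfl fun x _ => ?_
    by_cases hx : x.1.val = j
    · subst hx
      have hp : x.2.val < a (x.1.val + 1) := by
        have := blockLen_left r a x.1 (by omega)
        have := x.2.isLt
        omega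
      rw [if_pos rfl, dif_pos hp, upperHalf_apply M ⟨by omega, hy⟩, blockVec, if_pos (by omega)]
      rfl
    · rw [if_neg hx, blockVec, if_neg (by omega), zero_mul]
  · rw [blockVec, if_neg (by omega)]
    refine Finset.sum_eq_zero fun x _ => ?_
    by_cases hx : x.1.val = j
    · exact mul_eq_zero_of_right _ (upperHalf_apply_eq_zero M (fun h => hy (by omega)))
    · rw [blockVec, if_neg (by omega), zero_mul]

theorem ofBlocks_mem_gradeOne (r : ℕ) (a : ℕ → ℕ)
    (M : ∀ i : ℕ, Matrix (Fin (a i)) (Fin (a (i + 1))) ℂ) : ofBlocks r a M ∈ gradeOne r a := by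
  refine ⟨mem_soAlg.2 fun x y => ?_, fun x y h => ?_⟩
  · simp only [ofBlocks, flipIdx_flipIdx, neg_sub]
  · by_contra hxy
    refine h ?_
    rw [ofBlocks_apply, upperHalf_apply_eq_zero M (fun h => hxy h.2), upperHalf_apply_eq_zero M,
      sub_zero]
    rintro ⟨h1, h2⟩
    rw [flipIdx_fst] at h1 h2
    rw [flipIdx_fst] at h2
    have := x.1.isLt
    have := y.1.isLt
    omega

theorem ofBlocks_mulVec_blockVec {r : ℕ} {a : ℕ → ℕ}
    (M : ∀ i : ℕ, Matrix (Fin (a i)) (Fin (a (i + 1))) ℂ) {j : ℕ} (hj1 : 1 ≤ j) (hj : j ≤ r)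
    (v : Fin (a (j + 1)) → ℂ) :
    ofBlocks r a M *ᵥ blockVec r a (j + 1) v = blockVec r a j (M j *ᵥ v) := by
  rw [← upperHalf_mulVec_blockVec M hj1 hj]
  funext x
  refine Finset.sum_congr rfl fun y _ => ?_
  by_cases hy : y.1.val = j
  · refine congrArg (· * _) ((sub_eq_self (a := upperHalf r a M x y)).2
      (upperHalf_apply_eq_zero M ?_))
    rw [flipIdx_fst]
    omega
  · simp only [blockVec, add_left_inj, hy, if_false, mul_zero]

theorem blockVec_vecMul_ofBlocks {r : ℕ} {a : ℕ → ℕ}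
    (M : ∀ i : ℕ, Matrix (Fin (a i)) (Fin (a (i + 1))) ℂ) {j : ℕ} (hj1 : 1 ≤ j) (hj : j ≤ r)
    (v : Fin (a j) → ℂ) :
    blockVec r a j v ᵥ* ofBlocks r a M = blockVec r a (j + 1) (v ᵥ* M j) := by
  rw [← blockVec_vecMul_upperHalf M hj1 hj]
  funext y
  refine Finset.sum_congr rfl fun x _ => ?_
  by_cases hx : x.1.val + 1 = j
  · refine congrArg (_ * ·) ((sub_eq_self (a := upperHalf r a M x y)).2
      (upperHalf_apply_eq_zero M ?_))
    rw [flipIdx_fst, flipIdx_fst]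
    omega
  · simp only [blockVec, hx, if_false, zero_mul]

theorem ofBlocks_mulVec_oppVec {r : ℕ} {a : ℕ → ℕ}
    (M : ∀ i : ℕ, Matrix (Fin (a i)) (Fin (a (i + 1))) ℂ) {j : ℕ} (hj1 : 1 ≤ j) (hj : j ≤ r)
    (v : Fin (a j) → ℂ) :
    ofBlocks r a M *ᵥ oppVec r a j v = -oppVec r a (j + 1) (v ᵥ* M j) := by
  have hso := mem_soAlg.1 (ofBlocks_mem_gradeOne r a M).1
  funext x
  rw [Pi.neg_apply, oppVec, ← blockVec_vecMul_ofBlocks M hj1 hj]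
  simp only [mulVec, vecMul, dotProduct, ← Finset.sum_neg_distrib]
  rw [← sum_flipIdx]
  refine Finset.sum_congr rfl fun y _ => ?_
  have := hso y (flipIdx r a x)
  rw [flipIdx_flipIdx] at this
  rw [oppVec, flipIdx_flipIdx, this]
  ring

/-! ### Gram matrices as even powers -/

/-- The matrices `M_j ⋯ M_r J (M_j ⋯ M_r)ᵀ`. -/
noncomputable def blockGram (r : ℕ) (a : ℕ → ℕ)
    (M : ∀ i : ℕ, Matrix (Fin (a i)) (Fin (a (i + 1))) ℂ) (j : ℕ) :
    Matrix (Fin (a j)) (Fin (a j)) ℂ :=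
  if j ≤ r then M j * blockGram r a M (j + 1) * (M j)ᵀ
  else Matrix.of fun p q => if p.val + q.val + 1 = a j then 1 else 0
termination_by r + 1 - j

theorem blockGram_of_le {r : ℕ} {a : ℕ → ℕ}
    (M : ∀ i : ℕ, Matrix (Fin (a i)) (Fin (a (i + 1))) ℂ) {j : ℕ} (hj : j ≤ r) :
    blockGram r a M j = M j * blockGram r a M (j + 1) * (M j)ᵀ := by
  rw [blockGram, if_pos hj]

theorem blockGram_last {r : ℕ} {a : ℕ → ℕ}
    (M : ∀ i : ℕ, Matrix (Fin (a i)) (Fin (a (i + 1))) ℂ) :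
    blockGram r a M (r + 1) =
      Matrix.of fun p q => if p.val + q.val + 1 = a (r + 1) then 1 else 0 := by
  rw [blockGram, if_neg (by omega)]

/-- Starting in the mirror of block `j`, the first half of the steps multiplies by the transposed
blocks with a sign each, and the second half by the blocks themselves; in the middle block the
reversal of coordinates contributes `J`. -/
theorem pow_mulVec_oppVec {r : ℕ} {a : ℕ → ℕ}
    (M : ∀ i : ℕ, Matrix (Fin (a i)) (Fin (a (i + 1))) ℂ) (d : ℕ) :
    ∀ j, 1 ≤ j → j + d = r + 1 → ∀ v : Fin (a j) → ℂ, ofBlocks r a M ^ (2 * d) *ᵥ oppVec r a j v =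
      (-1 : ℂ) ^ d • blockVec r a j (blockGram r a M j *ᵥ v) := by
  induction d with
  | zero =>
    rintro j hj1 hj v
    obtain rfl : j = r + 1 := hj
    simp only [mul_zero, pow_zero, one_mulVec, one_smul, blockGram_last]
    funext x
    rw [oppVec, blockVec, blockVec, flipIdx_fst]
    by_cases hx : x.1.val = r
    · have hlen : blockLen r a x.1 = a (r + 1) := by
        unfold blockLen
        congr 1
        omega
      have h2 := x.2.isLt
      have hp : x.2.val < a (r + 1) := by omega
      rw [if_pos (by omega), if_pos (by omega), extendZero, extendZero, dif_pos hp]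
      have hf : (flipIdx r a x).2.val = a (r + 1) - 1 - x.2.val := by
        simp only [flipIdx, Fin.val_cast, Fin.val_rev]
        omega
      rw [dif_pos (by omega)]
      simp only [mulVec, dotProduct, Matrix.of_apply, ite_mul, one_mul, zero_mul]
      rw [Finset.sum_eq_single ⟨a (r + 1) - 1 - x.2.val, by omega⟩]
      · rw [if_pos (by simp only; omega)]
        congr 1
        exact Fin.ext hf
      · intro q _ hq
        refine if_neg fun h => hq (Fin.ext ?_)
        simp only
        omega
      · simp
    · rw [if_neg (by omega), if_neg (by omega)]
  | succ d ih =>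
    intro j hj1 hj v
    rw [show 2 * (d + 1) = 1 + 2 * d + 1 by ring, pow_succ, pow_add, pow_one, ← mulVec_mulVec,
      ofBlocks_mulVec_oppVec M hj1 (by omega), ← mulVec_mulVec, mulVec_neg, mulVec_neg,
      ih (j + 1) (by omega) (by omega), mulVec_smul, ofBlocks_mulVec_blockVec M hj1 (by omega),
      blockGram_of_le M (j := j) (by omega), ← mulVec_mulVec, ← mulVec_mulVec, mulVec_transpose,
      pow_succ]
    simp

/-- A wide matrix always has a kernel, and a square one has a kernel as soon as its rows are
dependent. -/
theorem exists_mulVec_eq_zero_of_vecMul {m n : ℕ} (hmn : m ≤ n) (A : Matrix (Fin m) (Fin n) ℂ)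
    {v : Fin m → ℂ} (hv : v ≠ 0) (h : v ᵥ* A = 0) : ∃ u ≠ 0, A *ᵥ u = 0 := by
  by_contra! hu
  have inj : Function.Injective A.mulVecLin := by
    rw [← LinearMap.ker_eq_bot, LinearMap.ker_eq_bot']
    intro u hu'
    by_contra h0
    exact hu u h0 hu'
  have hle := LinearMap.finrank_le_finrank_of_injective inj
  simp only [Module.finrank_fin_fun] at hle
  obtain rfl : m = n := le_antisymm hmn hle
  obtain ⟨u, hu0, hu'⟩ := Matrix.exists_mulVec_eq_zero_iff.2
    (Matrix.exists_vecMul_eq_zero_iff.1 ⟨v, hv, h⟩)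
  exact hu u hu0 hu'

/-- A null vector of the Gram matrix gives a vector `y` in the mirror block whose `X`-string ends
before reaching block `j`. Let `s` be its last nonzero exponent. If `s` is odd, the string is a
forbidden chain; if `s` is even and positive, so is the string of `X y`; if `s = 0`, then `M j` has
dependent rows and `y` pairs with a kernel vector of `M j`. -/
theorem not_isRichardson_of_gram {r : ℕ} {a : ℕ → ℕ}
    {M : ∀ i : ℕ, Matrix (Fin (a i)) (Fin (a (i + 1))) ℂ} {j : ℕ} (hj1 : 1 ≤ j) (hj : j ≤ r)
    (hja : a j ≤ a (j + 1)) {v : Fin (a j) → ℂ} (hv : v ≠ 0) (h : blockGram r a M j *ᵥ v = 0) :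
    ¬ IsRichardson r a (ofBlocks r a M) := by
  set X := ofBlocks r a M with hXdef
  have hX : X ∈ gradeOne r a := ofBlocks_mem_gradeOne r a M
  set y := oppVec r a j v with hydef
  have hy : y ∈ blockSpace r a (2 * r + 1 - j) := oppVec_mem (by omega) v
  have hy0 : y ≠ 0 := oppVec_ne_zero hj1 (by omega) hv
  have hnil : X ^ (2 * (r + 1 - j)) *ᵥ y = 0 := by
    rw [hXdef, hydef, pow_mulVec_oppVec M (r + 1 - j) j hj1 (by omega), h]
    have : blockVec r a j (0 : Fin (a j) → ℂ) = 0 := by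
      funext x
      simp [blockVec, extendZero]
    rw [this, smul_zero]
  obtain ⟨s, hs, hs'⟩ : ∃ s, X ^ s *ᵥ y ≠ 0 ∧ X ^ (s + 1) *ᵥ y = 0 := by
    classical
    have hex : ∃ n, X ^ n *ᵥ y = 0 := ⟨_, hnil⟩
    have h0 : Nat.find hex ≠ 0 := by
      intro h0
      have := Nat.find_spec hex
      rw [h0, pow_zero, one_mulVec] at this
      exact hy0 this
    refine ⟨Nat.find hex - 1, Nat.find_min hex (by omega), ?_⟩
    rw [Nat.sub_add_cancel (by omega)]
    exact Nat.find_spec hex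
  have hsj : s < 2 * (r + 1 - j) := by
    by_contra! hlt
    apply hs
    rw [← Nat.sub_add_cancel hlt, pow_add, ← mulVec_mulVec, hnil, mulVec_zero]
  rcases Nat.even_or_odd s with he | ho
  · obtain ⟨t, ht⟩ := he
    rcases Nat.eq_zero_or_pos s with rfl | hpos
    · rw [zero_add, pow_one, hXdef, hydef, ofBlocks_mulVec_oppVec M hj1 hj, neg_eq_zero] at hs'
      have hvM : v ᵥ* M j = 0 := by
        by_contra h0
        exact oppVec_ne_zero (by omega) (by omega) h0 hs'
      obtain ⟨u, hu0, hu⟩ := exists_mulVec_eq_zero_of_vecMul hja (M j) hv hvM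
      refine not_isRichardson_of_pair_of_ne hX (p := j) (q := 2 * r + 1 - j) (by omega) (by omega)
        (blockVec_mem u) hy ?_ ?_ (blockVec_ne_zero (by omega) (by omega) hu0) hy0
      · rw [hXdef, ofBlocks_mulVec_blockVec M hj1 hj, hu]
        funext x
        simp [blockVec, extendZero]
      · rw [hXdef, hydef, ofBlocks_mulVec_oppVec M hj1 hj, hs', neg_zero]
    · refine not_isRichardson_of_chain hX (q := 2 * r - j) (s := s - 1) (v := X *ᵥ y)
        ⟨t - 1, by omega⟩ (by omega) (mulVec_mem_blockSpace hX ?_) ?_ ?_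
      · rwa [show 2 * r - j + 1 = 2 * r + 1 - j by omega]
      · rw [Nat.sub_add_cancel hpos, mulVec_mulVec, ← pow_succ, hs']
      · rwa [mulVec_mulVec, ← pow_succ, Nat.sub_add_cancel hpos]
  · exact not_isRichardson_of_chain hX (q := 2 * r + 1 - j) ho (by omega) hy hs' hs

/-! ### Sufficiency: vanishing of the negative centralizer -/

/-- The symmetric bilinear form with matrix `J_N`. -/
def flipForm {r : ℕ} {a : ℕ → ℕ} (u w : Idx r a → ℂ) : ℂ := ∑ x, u x * w (flipIdx r a x)

theorem flipForm_comm {r : ℕ} {a : ℕ → ℕ} (u w : Idx r a → ℂ) :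
    flipForm u w = flipForm w u := by
  unfold flipForm
  rw [← sum_flipIdx]
  refine Finset.sum_congr rfl fun x _ => ?_
  rw [flipIdx_flipIdx, mul_comm]

theorem flipForm_add_right {r : ℕ} {a : ℕ → ℕ} (u v w : Idx r a → ℂ) :
    flipForm u (v + w) = flipForm u v + flipForm u w := by
  simp only [flipForm, Pi.add_apply, mul_add, Finset.sum_add_distrib]

theorem flipForm_smul_right {r : ℕ} {a : ℕ → ℕ} (c : ℂ) (u v : Idx r a → ℂ) :
    flipForm u (c • v) = c * flipForm u v := by
  simp only [flipForm, Pi.smul_apply, smul_eq_mul, Finset.mul_sum]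
  exact Finset.sum_congr rfl fun x _ => by ring

theorem flipForm_mulVec {r : ℕ} {a : ℕ → ℕ} {A : Matrix (Idx r a) (Idx r a) ℂ}
    (hA : A ∈ soAlg r a) (u w : Idx r a → ℂ) :
    flipForm (A *ᵥ u) w = -flipForm (A *ᵥ w) u := by
  rw [mem_soAlg] at hA
  simp only [flipForm, mulVec, dotProduct, Finset.sum_mul]
  rw [← sum_flipIdx, ← Finset.sum_neg_distrib, Finset.sum_comm]
  simp_rw [← Finset.sum_neg_distrib]
  conv_rhs => rw [← sum_flipIdx]
  refine Finset.sum_congr rfl fun y _ => ?_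
  refine Finset.sum_congr rfl fun x _ => ?_
  have := hA (flipIdx r a x) y
  rw [flipIdx_flipIdx] at this
  rw [flipIdx_flipIdx, flipIdx_flipIdx, this]
  ring

theorem eq_zero_of_flipForm {r : ℕ} {a : ℕ → ℕ} {k : ℕ} (hk : k ≤ 2 * r) {z : Idx r a → ℂ}
    (hz : z ∈ blockSpace r a (2 * r - k)) (h : ∀ f ∈ blockSpace r a k, flipForm z f = 0) :
    z = 0 := by
  funext x
  by_contra hx
  have hk' := hz x hx
  apply hx
  refine Eq.trans ?_ (h (Pi.single (flipIdx r a x) 1) ?_)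
  · rw [flipForm, Finset.sum_eq_single x]
    · simp
    · intro y _ hy
      rw [Pi.single_eq_of_ne, mul_zero]
      intro h'
      apply hy
      rw [← flipIdx_flipIdx y, h', flipIdx_flipIdx]
    · simp
  · intro y hy
    obtain rfl : y = flipIdx r a x := by
      by_contra h'
      exact hy (Pi.single_eq_of_ne h' _)
    rw [flipIdx_fst]
    omega

theorem eq_zero_iff_exists_of_finrank_eq {r : ℕ} {a : ℕ → ℕ}
    {X : Matrix (Idx r a) (Idx r a) ℂ} (hX : X ∈ gradeOne r a) {k s : ℕ}
    (h : Module.finrank ℂ (blockSpace r a (k + s)) = Module.finrank ℂ (blockSpace r a k)) :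
    (∀ v ∈ blockSpace r a (k + s), X ^ s *ᵥ v = 0 → v = 0) ↔
      ∀ u ∈ blockSpace r a k, ∃ v ∈ blockSpace r a (k + s), X ^ s *ᵥ v = u := by
  let f : blockSpace r a (k + s) →ₗ[ℂ] blockSpace r a k :=
    (X ^ s).mulVecLin.restrict fun v hv => pow_mulVec_mem_blockSpace hX s hv
  have hf := LinearMap.injective_iff_surjective_of_finrank_eq_finrank (f := f) h
  rw [← LinearMap.ker_eq_bot, LinearMap.ker_eq_bot'] at hf
  constructor
  · intro hi u hu
    obtain ⟨v, hv⟩ := hf.1 (fun v hv => Subtype.ext (hi v.1 v.2 (congrArg Subtype.val hv))) ⟨u, hu⟩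
    exact ⟨v.1, v.2, congrArg Subtype.val hv⟩
  · intro hs v hv hv0
    refine congrArg Subtype.val (hf.2 (fun u => ?_) ⟨v, hv⟩ (Subtype.ext hv0))
    obtain ⟨w, hw, hwu⟩ := hs u.1 u.2
    exact ⟨⟨w, hw⟩, Subtype.ext hwu⟩

/-- The component of degree `-j` of a matrix. -/
def lowerPart {r : ℕ} {a : ℕ → ℕ} (Z : Matrix (Idx r a) (Idx r a) ℂ) (j : ℕ) :
    Matrix (Idx r a) (Idx r a) ℂ :=
  fun x y => if x.1.val = y.1.val + j then Z x y else 0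

theorem lowerPart_mem_soAlg {r : ℕ} {a : ℕ → ℕ} {Z : Matrix (Idx r a) (Idx r a) ℂ}
    (hZ : Z ∈ soAlg r a) (j : ℕ) : lowerPart Z j ∈ soAlg r a := by
  rw [mem_soAlg] at hZ ⊢
  intro x y
  have hx := x.1.isLt
  have hy := y.1.isLt
  simp only [lowerPart, flipIdx_fst, hZ x y]
  by_cases h : x.1.val = y.1.val + j
  · rw [if_pos h, if_pos (by omega)]
  · rw [if_neg h, if_neg (by omega), neg_zero]

theorem ite_zero_sum {ι : Type*} [Fintype ι] (p : Prop) [Decidable p] (f : ι → ℂ) :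
    (if p then ∑ i, f i else 0) = ∑ i, if p then f i else 0 := by
  split_ifs <;> simp

theorem mul_lowerPart_comm {r : ℕ} {a : ℕ → ℕ} {X Z : Matrix (Idx r a) (Idx r a) ℂ}
    (hX : X ∈ gradeOne r a) (h : X * Z = Z * X) (j : ℕ) :
    X * lowerPart Z j = lowerPart Z j * X := by
  ext x y
  have e1 : (X * lowerPart Z j) x y =
      if x.1.val + 1 = y.1.val + j then (X * Z) x y else 0 := by
    rw [Matrix.mul_apply, Matrix.mul_apply, ite_zero_sum]
    refine Finset.sum_congr rfl fun z _ => ?_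
    by_cases hz : X x z = 0
    · simp [hz]
    · rw [lowerPart, hX.2 x z hz, mul_ite, mul_zero]
  have e2 : (lowerPart Z j * X) x y =
      if x.1.val + 1 = y.1.val + j then (Z * X) x y else 0 := by
    rw [Matrix.mul_apply, Matrix.mul_apply, ite_zero_sum]
    refine Finset.sum_congr rfl fun z _ => ?_
    by_cases hz : X z y = 0
    · simp [hz]
    · rw [lowerPart, hX.2 z y hz, ite_mul, zero_mul]
      refine if_congr ?_ rfl rfl
      omega
  rw [e1, e2, h]

theorem lowerPart_mulVec_mem {r : ℕ} {a : ℕ → ℕ} (Z : Matrix (Idx r a) (Idx r a) ℂ) {j k : ℕ}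
    {v : Idx r a → ℂ} (hv : v ∈ blockSpace r a k) :
    lowerPart Z j *ᵥ v ∈ blockSpace r a (k + j) := by
  intro x hx
  obtain ⟨y, -, hy⟩ := Finset.exists_ne_zero_of_sum_ne_zero hx
  rw [← hv y (right_ne_zero_of_mul hy)]
  by_contra h
  exact left_ne_zero_of_mul hy (if_neg h)

theorem eq_zero_of_lowerPart {r : ℕ} {a : ℕ → ℕ} {Z : Matrix (Idx r a) (Idx r a) ℂ}
    (hlow : ∀ x y, Z x y ≠ 0 → y.1.val < x.1.val)
    (h : ∀ j, 1 ≤ j → ∀ k, k ≤ 2 * r → ∀ v ∈ blockSpace r a k, lowerPart Z j *ᵥ v = 0) :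
    Z = 0 := by
  ext x y
  by_contra hxy
  have hlt := hlow x y hxy
  apply hxy
  have hy := y.1.isLt
  have := congrFun (h (x.1.val - y.1.val) (by omega) y.1.val (by omega) (Pi.single y 1) (by
    intro z hz
    obtain rfl : z = y := by
      by_contra h'
      exact hz (Pi.single_eq_of_ne h' _)
    rfl)) x
  rw [mulVec_single_one] at this
  simp only [Matrix.col_apply, lowerPart, Pi.zero_apply] at this
  rwa [if_pos (by omega)] at this

theorem pow_mulVec_comm {r : ℕ} {a : ℕ → ℕ} {X Z : Matrix (Idx r a) (Idx r a) ℂ}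
    (h : X * Z = Z * X) (s : ℕ) (v : Idx r a → ℂ) :
    X ^ s *ᵥ (Z *ᵥ v) = Z *ᵥ (X ^ s *ᵥ v) := by
  rw [mulVec_mulVec, mulVec_mulVec, ((show Commute X Z from h).pow_left s).eq]

/-- A commuting element splits into homogeneous parts that commute as well. For such a part `Z`,
descending induction on the block index shows that `Z` kills each block. Since `Z X y = X Z y`, a
vector matters only modulo the image of `X`; it can be corrected so that a power of `X` kills it,
and injectivity of powers of `X` on the target block then kills its image. The only target without
injectivity is the mirror of block `l`, and when `Z` maps block `l` to its own mirror, skew-symmetry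
takes over. -/
theorem isRichardson_of_hasDescentAt {r : ℕ} {a : ℕ → ℕ} {X : Matrix (Idx r a) (Idx r a) ℂ}
    (hX : X ∈ gradeOne r a) {l : ℕ} (hl2 : 2 ≤ l) (hlr : l ≤ r) (hd : HasDescentAt r a l)
    (heq : a (l - 1) = a (l + 1))
    (hinj : ∀ d, d ≤ r → d + l ≠ r + 1 → ∀ v ∈ blockSpace r a (r + d),
      X ^ (2 * d) *ᵥ v = 0 → v = 0) :
    IsRichardson r a X := by
  -- The two blocks of exceptional length `a l` have indices `r - e` and `r + e`.
  obtain ⟨e, he⟩ : ∃ e, e + l = r + 1 := ⟨r + 1 - l, by omega⟩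
  have hconst : ∀ k, r ≤ k + e → k ≤ r + e + 1 → k + e ≠ r → k ≠ r + e →
      Module.finrank ℂ (blockSpace r a k) = a (l + 1) := by
    intro k h1 h2 h3 h4
    rcases le_total k r with h | h
    · rw [finrank_blockSpace_left h]
      exact hd.const _ (by omega) (by omega)
    · rw [finrank_blockSpace_right h (by omega)]
      by_cases hk : k = r + e + 1
      · rw [← heq]
        congr 1
        omega
      · exact hd.const _ (by omega) (by omega)
  have hL1 : Module.finrank ℂ (blockSpace r a (r - e - 1)) = a (l + 1) := by
    rw [finrank_blockSpace_left (by omega), ← heq]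
    congr 1
    omega
  have hL : Module.finrank ℂ (blockSpace r a (r - e)) = a (l + 1) + 1 := by
    rw [finrank_blockSpace_left (by omega), ← hd.drop]
    congr 1
    omega
  have hsurj : ∀ d, d ≤ r → d ≠ e → ∀ u ∈ blockSpace r a (r - d),
      ∃ v ∈ blockSpace r a (r + d), X ^ (2 * d) *ᵥ v = u := by
    intro d hdr hde
    have h := eq_zero_iff_exists_of_finrank_eq hX (k := r - d) (s := 2 * d) (by
      rw [finrank_blockSpace_right (by omega) (by omega), finrank_blockSpace_left (by omega)]
      congr 1
      omega)
    rw [show r - d + 2 * d = r + d by omega] at h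
    exact h.1 (hinj d hdr (by omega))
  -- `X²` jumps over the exceptional block between two blocks of equal dimension. It is injective
  -- there as the first factor of the injective `X ^ (2 * (e + 1))`.
  have hsq' : ∀ u ∈ blockSpace r a (r + e - 1), ∃ v ∈ blockSpace r a (r + e + 1),
      X ^ 2 *ᵥ v = u := by
    have h := eq_zero_iff_exists_of_finrank_eq hX (k := r + e - 1) (s := 2) (by
      rw [hconst _ (by omega) (by omega) (by omega) (by omega),
        hconst _ (by omega) (by omega) (by omega) (by omega)])
    rw [show r + e - 1 + 2 = r + e + 1 by omega] at h
    refine h.1 fun v hv hv0 => hinj (e + 1) (by omega) (by omega) v hv ?_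
    rw [show 2 * (e + 1) = 2 * e + 2 by ring, pow_add, ← mulVec_mulVec, hv0, mulVec_zero]
  have hsq : ∀ u ∈ blockSpace r a (r - e - 1), ∃ v ∈ blockSpace r a (r - e + 1),
      X ^ 2 *ᵥ v = u := by
    intro u hu
    obtain ⟨v, hv, hvu⟩ := hsurj (e + 1) (by omega) (by omega) u
      (by rwa [show r - (e + 1) = r - e - 1 by omega])
    refine ⟨X ^ (2 * e) *ᵥ v, pow_mulVec_mem_blockSpace hX _ ?_, ?_⟩
    · rwa [show r - e + 1 + 2 * e = r + (e + 1) by omega]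
    · rw [mulVec_mulVec, ← pow_add, show 2 + 2 * e = 2 * (e + 1) by ring, hvu]
  have injX : ∀ m, r - e < m → m ≠ r + e → ∀ z ∈ blockSpace r a m, X *ᵥ z = 0 → z = 0 := by
    intro m hm hme z hz hXz
    rcases lt_or_ge (2 * r) m with h | h
    · exact mem_blockSpace_of_lt h hz
    rcases lt_or_ge r m with h' | h'
    · refine hinj (m - r) (by omega) (by omega) z (by rwa [show r + (m - r) = m by omega]) ?_
      rw [show 2 * (m - r) = 2 * (m - r) - 1 + 1 by omega, pow_succ, ← mulVec_mulVec, hXz,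
        mulVec_zero]
    by_cases hm1 : m = r - e + 1
    · subst hm1
      have h := eq_zero_iff_exists_of_finrank_eq hX (k := r - e - 1) (s := 2) (by
        rw [hL1, hconst _ (by omega) (by omega) (by omega) (by omega)])
      rw [show r - e - 1 + 2 = r - e + 1 by omega] at h
      refine h.2 hsq z hz ?_
      rw [pow_two, ← mulVec_mulVec, hXz, mulVec_zero]
    · have h := eq_zero_iff_exists_of_finrank_eq hX (k := m - 1) (s := 1) (by
        rw [hconst _ (by omega) (by omega) (by omega) (by omega),
          hconst _ (by omega) (by omega) (by omega) (by omega)])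
      rw [show m - 1 + 1 = m by omega] at h
      refine h.2 (fun u hu => ?_) z hz (by rwa [pow_one])
      obtain ⟨v, hv, hvu⟩ := hsurj (r - (m - 1)) (by omega) (by omega) u
        (by rwa [show r - (r - (m - 1)) = m - 1 by omega])
      refine ⟨X ^ (2 * (r - (m - 1)) - 1) *ᵥ v, pow_mulVec_mem_blockSpace hX _ ?_, ?_⟩
      · rwa [show m + (2 * (r - (m - 1)) - 1) = r + (r - (m - 1)) by omega]
      · rw [mulVec_mulVec, ← pow_add, show 1 + (2 * (r - (m - 1)) - 1) = 2 * (r - (m - 1)) by omega,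
          hvu]
  -- Surjectivity of `X` onto the next block, whose dimension is one less, leaves a one-dimensional
  -- kernel.
  have hline : ∀ u ∈ blockSpace r a (r - e), X *ᵥ u = 0 → u ≠ 0 →
      ∀ w ∈ blockSpace r a (r - e), X *ᵥ w = 0 → ∃ c : ℂ, w = c • u := by
    intro u hu hXu hu0 w hw hXw
    have hk : r - e = r - e - 1 + 1 := by omega
    rw [hk] at hu hw hL
    let f : blockSpace r a (r - e - 1 + 1) →ₗ[ℂ] blockSpace r a (r - e - 1) :=
      X.mulVecLin.restrict fun v hv => mulVec_mem_blockSpace hX hv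
    have hfs : Function.Surjective f := by
      intro t
      obtain ⟨v, hv, hvt⟩ := hsq t.1 t.2
      refine ⟨⟨X *ᵥ v, mulVec_mem_blockSpace hX ?_⟩, Subtype.ext ?_⟩
      · rwa [← hk]
      · rw [← hvt, pow_two, ← mulVec_mulVec]
        rfl
    have hker : Module.finrank ℂ (LinearMap.ker f) = 1 := by
      have h1 := LinearMap.finrank_range_add_finrank_ker f
      rw [LinearMap.range_eq_top.2 hfs, finrank_top, hL1, hL] at h1
      omega
    obtain ⟨c, hc⟩ := (finrank_eq_one_iff_of_nonzero'
      (⟨⟨u, hu⟩, Subtype.ext hXu⟩ : LinearMap.ker f)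
      (fun h => hu0 (congrArg (fun t => t.1.1) h))).1 hker ⟨⟨w, hw⟩, Subtype.ext hXw⟩
    exact ⟨c, (congrArg (fun t => t.1.1) hc).symm⟩
  refine isRichardson_of_forall_commute hX fun Z₀ hZ₀ hlow hcomm₀ =>
    eq_zero_of_lowerPart hlow fun j hj => ?_
  have hZ := lowerPart_mem_soAlg hZ₀ j
  have hcomm := mul_lowerPart_comm hX hcomm₀ j
  have hmem : ∀ k, ∀ v ∈ blockSpace r a k, lowerPart Z₀ j *ᵥ v ∈ blockSpace r a (k + j) :=
    fun k v hv => lowerPart_mulVec_mem Z₀ hv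
  set Z := lowerPart Z₀ j
  have hpow := pow_mulVec_comm hcomm
  have key : ∀ n k, k + n = 2 * r → ∀ v ∈ blockSpace r a k, Z *ᵥ v = 0 := by
    intro n
    induction n with
    | zero => exact fun k hk v hv => mem_blockSpace_of_lt (by omega) (hmem k v hv)
    | succ n ih =>
      intro k hk v hv
      replace ih := ih (k + 1) (by omega)
      have step : ∀ y ∈ blockSpace r a (k + 1), Z *ᵥ (v - X *ᵥ y) = 0 → Z *ᵥ v = 0 := by
        intro y hy h
        have h1 := hpow 1 y
        rw [pow_one, ih y hy, mulVec_zero] at h1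
        rwa [mulVec_sub, ← h1, sub_zero] at h
      have step' : ∀ y ∈ blockSpace r a (k + 1), v = X *ᵥ y → Z *ᵥ v = 0 := by
        intro y hy h
        refine step y hy ?_
        rw [h, sub_self, mulVec_zero]
      have hXk : ∀ y ∈ blockSpace r a (k + 1), X *ᵥ y ∈ blockSpace r a k :=
        fun y hy => mulVec_mem_blockSpace hX hy
      rcases lt_or_ge (r + e) k with h1 | h1
      · obtain ⟨y, hy, hyv⟩ := hsurj (k - r + 1) (by omega) (by omega) (X ^ (2 * (k - r) + 1) *ᵥ v)
          (pow_mulVec_mem_blockSpace hX _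
            (by rwa [show r - (k - r + 1) + (2 * (k - r) + 1) = k by omega]))
        rw [show r + (k - r + 1) = k + 1 by omega] at hy
        refine step y hy ?_
        -- The corrected vector dies after `2 (k - r) + 1` steps, fewer than the `2 (k + j - r)`
        -- steps on which `X` is injective from block `k + j`; here `j ≥ 1` is used.
        have hu0 : X ^ (2 * (k - r) + 1) *ᵥ (v - X *ᵥ y) = 0 := by
          rw [mulVec_sub, mulVec_mulVec, ← pow_succ,
            show 2 * (k - r) + 1 + 1 = 2 * (k - r + 1) by ring, hyv, sub_self]
        have hz := hmem k _ ((blockSpace r a k).sub_mem hv (hXk y hy))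
        have hz0 := hpow (2 * (k - r) + 1) (v - X *ᵥ y)
        rw [hu0, mulVec_zero] at hz0
        rcases lt_or_ge (2 * r) (k + j) with h | h
        · exact mem_blockSpace_of_lt h hz
        · refine hinj (k + j - r) (by omega) (by omega) _
            (by rwa [show r + (k + j - r) = k + j by omega]) ?_
          rw [show 2 * (k + j - r) = 2 * j - 1 + (2 * (k - r) + 1) by omega, pow_add,
            ← mulVec_mulVec, hz0, mulVec_zero]
      by_cases h2 : k = r + e
      · subst h2
        obtain ⟨y, hy, hyv⟩ := hsq' (X *ᵥ v) (mulVec_mem_blockSpace hX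
          (by rwa [Nat.sub_add_cancel (by omega)]))
        refine step y hy ?_
        have hu0 : X *ᵥ (v - X *ᵥ y) = 0 := by
          rw [mulVec_sub, mulVec_mulVec, ← pow_two, hyv, sub_self]
        have hz := hmem _ _ ((blockSpace r a _).sub_mem hv (hXk y hy))
        have hz0 := hpow 1 (v - X *ᵥ y)
        rw [pow_one, hu0, mulVec_zero] at hz0
        exact injX _ (by omega) (by omega) _ hz hz0
      by_cases h3 : k = r - e
      · subst h3
        obtain ⟨y, hy, hyv⟩ := hsq (X *ᵥ v) (mulVec_mem_blockSpace hX
          (by rwa [Nat.sub_add_cancel (by omega)]))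
        refine step y hy ?_
        have hu0 : X *ᵥ (v - X *ᵥ y) = 0 := by
          rw [mulVec_sub, mulVec_mulVec, ← pow_two, hyv, sub_self]
        have hu := (blockSpace r a _).sub_mem hv (hXk y hy)
        set u := v - X *ᵥ y
        have hz := hmem _ _ hu
        have hz0 := hpow 1 u
        rw [pow_one, hu0, mulVec_zero] at hz0
        by_cases hje : r - e + j = r + e
        · by_cases hu1 : u = 0
          · rw [hu1, mulVec_zero]
          refine eq_zero_of_flipForm (k := r - e) (by omega)
            (by rwa [show 2 * r - (r - e) = r - e + j by omega]) fun f hf => ?_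
          obtain ⟨y', hy', hyf⟩ := hsq (X *ᵥ f) (mulVec_mem_blockSpace hX
            (by rwa [Nat.sub_add_cancel (by omega)]))
          obtain ⟨c, hc⟩ := hline u hu hu0 hu1 (f - X *ᵥ y')
            ((blockSpace r a _).sub_mem hf (hXk y' hy'))
            (by rw [mulVec_sub, mulVec_mulVec, ← pow_two, hyf, sub_self])
          have hf' : f = c • u + X *ᵥ y' := by rw [← hc, sub_add_cancel]
          -- It is enough to pair `Z u` with block `r - e`, which is spanned by `u` and the image of
          -- `X`. The first pairing vanishes because `Z` is skew, the second because `X Z u = 0`.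
          have hself : flipForm (Z *ᵥ u) u = 0 := self_eq_neg.1 (flipForm_mulVec hZ u u)
          rw [hf', flipForm_add_right, flipForm_smul_right, hself, flipForm_comm _ (X *ᵥ y'),
            flipForm_mulVec hX.1, hz0]
          simp [flipForm]
        · exact injX _ (by omega) hje _ hz hz0
      rcases lt_or_ge k r with h4 | h4
      · obtain ⟨y, hy, hyv⟩ := hsurj (r - k) (by omega) (by omega) v
          (by rwa [show r - (r - k) = k by omega])
        refine step' (X ^ (2 * (r - k) - 1) *ᵥ y) (pow_mulVec_mem_blockSpace hX _ ?_) ?_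
        · rwa [show k + 1 + (2 * (r - k) - 1) = r + (r - k) by omega]
        · rw [mulVec_mulVec, ← pow_succ', show 2 * (r - k) - 1 + 1 = 2 * (r - k) by omega, hyv]
      by_cases h5 : k + 1 = r + e
      · obtain ⟨y, hy, hyv⟩ := hsq' v (by rwa [show r + e - 1 = k by omega])
        refine step' (X *ᵥ y) (mulVec_mem_blockSpace hX (by rwa [h5])) ?_
        rw [mulVec_mulVec, ← pow_two, hyv]
      · have h := eq_zero_iff_exists_of_finrank_eq hX (k := k) (s := 1) (by
          rw [hconst _ (by omega) (by omega) (by omega) (by omega),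
            hconst _ (by omega) (by omega) (by omega) (by omega)])
        obtain ⟨y, hy, hyv⟩ := h.1 (fun z hz hz0 => injX _ (by omega) (by omega) z hz
          (by rwa [pow_one] at hz0)) v hv
        exact step' y hy (by rw [← hyv, pow_one])
  exact fun k hk => key (2 * r - k) k (by omega)

/-! ### Supports of products of nonnegative matrices -/

theorem mul_apply_ne_zero_iff {l m n : ℕ} {A : Matrix (Fin l) (Fin m) ℂ}
    {B : Matrix (Fin m) (Fin n) ℂ} (hA : ∀ i j, 0 ≤ A i j) (hB : ∀ i j, 0 ≤ B i j)
    (i : Fin l) (k : Fin n) : (A * B) i k ≠ 0 ↔ ∃ j, A i j ≠ 0 ∧ B j k ≠ 0 := by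
  rw [Matrix.mul_apply, Ne, Finset.sum_eq_zero_iff_of_nonneg fun j _ => mul_nonneg (hA i j) (hB j k)]
  simp [not_or]

theorem mul_apply_nonneg {l m n : ℕ} {A : Matrix (Fin l) (Fin m) ℂ}
    {B : Matrix (Fin m) (Fin n) ℂ} (hA : ∀ i j, 0 ≤ A i j) (hB : ∀ i j, 0 ≤ B i j)
    (i : Fin l) (k : Fin n) : 0 ≤ (A * B) i k :=
  Finset.sum_nonneg fun j _ => mul_nonneg (hA i j) (hB j k)

/-- A matrix with positive entries on the skew-diagonal and zeros elsewhere. -/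
def IsAntidiagPos {n : ℕ} (S : Matrix (Fin n) (Fin n) ℂ) : Prop :=
  (∀ p q, 0 ≤ S p q) ∧ ∀ p q, S p q ≠ 0 ↔ p.val + q.val + 1 = n

theorem IsAntidiagPos.eq_zero_of_mulVec {n : ℕ} {S : Matrix (Fin n) (Fin n) ℂ}
    (hS : IsAntidiagPos S) {v : Fin n → ℂ} (hv : S *ᵥ v = 0) : v = 0 := by
  funext q
  have hq := q.isLt
  have := congrFun hv ⟨n - 1 - q, by omega⟩
  rw [mulVec, dotProduct, Finset.sum_eq_single q] at this
  · refine (mul_eq_zero.1 this).resolve_left ((hS.2 _ _).2 ?_)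
    simp only
    omega
  · intro x _ hx
    rw [mul_eq_zero]
    left
    by_contra h
    have h' := (hS.2 _ _).1 h
    simp only at h'
    exact hx (Fin.ext (by omega))
  · simp

theorem IsAntidiagPos.congr {m n : ℕ} {S : Matrix (Fin n) (Fin n) ℂ} (hS : IsAntidiagPos S)
    {A : Matrix (Fin m) (Fin n) ℂ} (hA : ∀ i j, 0 ≤ A i j)
    (h1 : ∀ p q x y, A p x ≠ 0 → x.val + y.val + 1 = n → A q y ≠ 0 → p.val + q.val + 1 = m)
    (h2 : ∀ p q : Fin m, p.val + q.val + 1 = m →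
      ∃ x y, A p x ≠ 0 ∧ x.val + y.val + 1 = n ∧ A q y ≠ 0) :
    IsAntidiagPos (A * S * Aᵀ) := by
  have hAS := mul_apply_nonneg hA hS.1
  have hT : ∀ i j, 0 ≤ Aᵀ i j := fun i j => hA j i
  refine ⟨mul_apply_nonneg hAS hT, fun p q => ?_⟩
  rw [mul_apply_ne_zero_iff hAS hT]
  constructor
  · rintro ⟨y, hy, hy'⟩
    obtain ⟨x, hx, hxy⟩ := (mul_apply_ne_zero_iff hA hS.1 _ _).1 hy
    exact h1 p q x y hx ((hS.2 _ _).1 hxy) hy'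
  · intro h
    obtain ⟨x, y, hx, hxy, hy⟩ := h2 p q h
    exact ⟨y, (mul_apply_ne_zero_iff hA hS.1 _ _).2 ⟨x, hx, (hS.2 _ _).2 hxy⟩, hy⟩

theorem IsAntidiagPos.congr_mul {k m n : ℕ} {S : Matrix (Fin n) (Fin n) ℂ} (hS : IsAntidiagPos S)
    {A : Matrix (Fin k) (Fin m) ℂ} {B : Matrix (Fin m) (Fin n) ℂ} (hA : ∀ i j, 0 ≤ A i j)
    (hB : ∀ i j, 0 ≤ B i j)
    (h1 : ∀ p q x y z w, A p x ≠ 0 → B x y ≠ 0 → y.val + z.val + 1 = n → B w z ≠ 0 → A q w ≠ 0 →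
      p.val + q.val + 1 = k)
    (h2 : ∀ p q : Fin k, p.val ≤ q.val → p.val + q.val + 1 = k →
      ∃ x y z w, A p x ≠ 0 ∧ B x y ≠ 0 ∧ y.val + z.val + 1 = n ∧ B w z ≠ 0 ∧ A q w ≠ 0) :
    IsAntidiagPos (A * (B * S * Bᵀ) * Aᵀ) := by
  have e : A * (B * S * Bᵀ) * Aᵀ = (A * B) * S * (A * B)ᵀ := by
    rw [transpose_mul]
    simp only [Matrix.mul_assoc]
  rw [e]
  refine hS.congr (mul_apply_nonneg hA hB) ?_ ?_
  · intro p q y z hy hyz hz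
    obtain ⟨x, hx, hxy⟩ := (mul_apply_ne_zero_iff hA hB _ _).1 hy
    obtain ⟨w, hw, hwz⟩ := (mul_apply_ne_zero_iff hA hB _ _).1 hz
    exact h1 p q x y z w hx hxy hyz hwz hw
  · intro p q hpq
    rcases le_total p.val q.val with h | h
    · obtain ⟨x, y, z, w, hx, hxy, hyz, hwz, hw⟩ := h2 p q h hpq
      exact ⟨y, z, (mul_apply_ne_zero_iff hA hB _ _).2 ⟨x, hx, hxy⟩, hyz,
        (mul_apply_ne_zero_iff hA hB _ _).2 ⟨w, hw, hwz⟩⟩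
    · obtain ⟨x, y, z, w, hx, hxy, hyz, hwz, hw⟩ := h2 q p h (by omega)
      exact ⟨z, y, (mul_apply_ne_zero_iff hA hB _ _).2 ⟨w, hw, hwz⟩, by omega,
        (mul_apply_ne_zero_iff hA hB _ _).2 ⟨x, hx, hxy⟩⟩

/-- Here no positivity is needed: if no row has a support column mirroring one of row `p`, every
summand in column `p` is zero. -/
theorem congr_mulVec_single_eq_zero {m n : ℕ} {S : Matrix (Fin n) (Fin n) ℂ}
    (hS : ∀ x y, S x y ≠ 0 → x.val + y.val + 1 = n) {A : Matrix (Fin m) (Fin n) ℂ} (p : Fin m)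
    (h : ∀ q x y, A q x ≠ 0 → x.val + y.val + 1 = n → A p y ≠ 0 → False) :
    (A * S * Aᵀ) *ᵥ Pi.single p 1 = 0 := by
  rw [mulVec_single_one]
  funext q
  rw [Matrix.col_apply, Matrix.mul_apply]
  refine Finset.sum_eq_zero fun y _ => ?_
  rw [Matrix.mul_apply, Finset.sum_mul]
  refine Finset.sum_eq_zero fun x _ => ?_
  by_contra h0
  exact h q x y (left_ne_zero_of_mul (left_ne_zero_of_mul h0))
    (hS x y (right_ne_zero_of_mul (left_ne_zero_of_mul h0))) (right_ne_zero_of_mul h0)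

theorem congr_mul_mulVec_single_eq_zero {k m n : ℕ} {S : Matrix (Fin n) (Fin n) ℂ}
    (hS : ∀ x y, S x y ≠ 0 → x.val + y.val + 1 = n) {A : Matrix (Fin k) (Fin m) ℂ}
    {B : Matrix (Fin m) (Fin n) ℂ} (p : Fin k)
    (h : ∀ q x y z w, A q x ≠ 0 → B x y ≠ 0 → y.val + z.val + 1 = n → B w z ≠ 0 → A p w ≠ 0 →
      False) :
    (A * (B * S * Bᵀ) * Aᵀ) *ᵥ Pi.single p 1 = 0 := by
  have e : A * (B * S * Bᵀ) * Aᵀ = (A * B) * S * (A * B)ᵀ := by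
    rw [transpose_mul]
    simp only [Matrix.mul_assoc]
  rw [e]
  have hmul : ∀ i j, (A * B) i j ≠ 0 → ∃ t, A i t ≠ 0 ∧ B t j ≠ 0 := by
    intro i j hij
    rw [Matrix.mul_apply] at hij
    obtain ⟨t, -, ht⟩ := Finset.exists_ne_zero_of_sum_ne_zero hij
    exact ⟨t, left_ne_zero_of_mul ht, right_ne_zero_of_mul ht⟩
  refine congr_mulVec_single_eq_zero hS p fun q y z hy hyz hz => ?_
  obtain ⟨x, hx, hxy⟩ := hmul _ _ hy
  obtain ⟨w, hw, hwz⟩ := hmul _ _ hz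
  exact h q x y z w hx hxy hyz hwz hw

theorem congr_mul_mulVec_eq_zero {k m n : ℕ} (S : Matrix (Fin n) (Fin n) ℂ)
    {A : Matrix (Fin k) (Fin m) ℂ} {B : Matrix (Fin m) (Fin n) ℂ} {u : Fin k → ℂ}
    (h : u ᵥ* (A * B) = 0) : (A * (B * S * Bᵀ) * Aᵀ) *ᵥ u = 0 := by
  have e : A * (B * S * Bᵀ) * Aᵀ = (A * B) * S * (A * B)ᵀ := by
    rw [transpose_mul]
    simp only [Matrix.mul_assoc]
  rw [e, ← mulVec_mulVec, mulVec_transpose, h, mulVec_zero]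

/-! ### Recipe blocks on increasing steps -/

theorem cornerBlock_nonneg (m n s t : ℕ) (p : Fin m) (q : Fin n) : 0 ≤ cornerBlock m n s t p q := by
  unfold cornerBlock
  split_ifs <;> simp

theorem centerBlock_nonneg (m n : ℕ) (p : Fin m) (q : Fin n) : 0 ≤ centerBlock m n p q := by
  unfold centerBlock
  split_ifs <;> simp

theorem cornerBlock_ne_zero_iff {m n s t : ℕ} {p : Fin m} {q : Fin n} :
    cornerBlock m n s t p q ≠ 0 ↔
      (p.val < s ∧ p.val + q.val + 1 = n) ∨ (q.val < t ∧ p.val + q.val + 1 = m) := by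
  unfold cornerBlock
  split_ifs with h <;> simp [h]

theorem centerBlock_ne_zero_iff {m n : ℕ} {p : Fin m} {q : Fin n} :
    centerBlock m n p q ≠ 0 ↔ p.val + q.val + 1 = m + (n - m) / 2 := by
  unfold centerBlock
  split_ifs with h <;> simp [h]

theorem recipeBlock_of_parity_eq {a : ℕ → ℕ} {i : ℕ} (h : a i % 2 = a (i + 1) % 2) :
    recipeBlock a i = centerBlock (a i) (a (i + 1)) := by
  rw [recipeBlock, if_pos (by rw [Nat.odd_iff, Nat.odd_iff, h])]

theorem recipeBlock_of_drop_odd {a : ℕ → ℕ} {i : ℕ} (h : a i = a (i + 1) + 1) (he : a i % 2 = 0)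
    (hi : i % 2 = 1) : recipeBlock a i =
      cornerBlock (a i) (a (i + 1)) ((a i + 1) / 2 - 1) ((a i + 1) / 2) := by
  rw [recipeBlock, if_neg (by rw [Nat.odd_iff, Nat.odd_iff]; omega),
    if_pos ⟨h, Nat.even_iff.2 he⟩, if_pos (Nat.odd_iff.2 hi)]

theorem recipeBlock_of_drop_even {a : ℕ → ℕ} {i : ℕ} (h : a i = a (i + 1) + 1)
    (he : a i % 2 = 0) (hi : i % 2 = 0) : recipeBlock a i =
      cornerBlock (a i) (a (i + 1)) ((a i + 1) / 2) ((a i + 1) / 2 - 1) := by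
  rw [recipeBlock, if_neg (by rw [Nat.odd_iff, Nat.odd_iff]; omega),
    if_pos ⟨h, Nat.even_iff.2 he⟩, if_neg (by rw [Nat.odd_iff]; omega)]

theorem recipeBlock_of_parity_ne {a : ℕ → ℕ} {i : ℕ} (h : a i % 2 ≠ a (i + 1) % 2)
    (h' : ¬ (a i = a (i + 1) + 1 ∧ a i % 2 = 0)) : recipeBlock a i =
      cornerBlock (a i) (a (i + 1)) ((a i + 1) / 2) ((a i + 1) / 2) := by
  rw [recipeBlock, if_neg (by rw [Nat.odd_iff, Nat.odd_iff]; omega),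
    if_neg (by rwa [Nat.even_iff])]

theorem sparseBlock_of_odd {a : ℕ → ℕ} {i : ℕ} (hi : i % 2 = 1) :
    sparseBlock a i = cornerBlock (a i) (a (i + 1)) (a i / 2) ((a i + 1) / 2) := by
  rw [sparseBlock, if_pos (Nat.odd_iff.2 hi)]

theorem sparseBlock_of_even {a : ℕ → ℕ} {i : ℕ} (hi : i % 2 = 0) :
    sparseBlock a i = cornerBlock (a i) (a (i + 1)) ((a i + 1) / 2) (a i / 2) := by
  rw [sparseBlock, if_neg (by rw [Nat.odd_iff]; omega)]

/-- Mirrored rows are supported on mirrored columns. In the corner form with an odd number of rows,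
the middle row belongs to both corners and so contains a mirrored pair of ones by itself. -/
theorem IsAntidiagPos.recipeBlock_congr {a : ℕ → ℕ} {i : ℕ} (hi : a i ≤ a (i + 1))
    {S : Matrix (Fin (a (i + 1))) (Fin (a (i + 1))) ℂ} (hS : IsAntidiagPos S) :
    IsAntidiagPos (recipeBlock a i * S * (recipeBlock a i)ᵀ) := by
  by_cases hpar : a i % 2 = a (i + 1) % 2
  · rw [recipeBlock_of_parity_eq hpar]
    refine hS.congr (centerBlock_nonneg _ _) ?_ ?_
    · intro p q x y
      simp only [centerBlock_ne_zero_iff]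
      omega
    · intro p q hpq
      have hp := p.isLt
      have hq := q.isLt
      refine ⟨⟨a i + (a (i + 1) - a i) / 2 - 1 - p, by omega⟩,
        ⟨a i + (a (i + 1) - a i) / 2 - 1 - q, by omega⟩, ?_⟩
      simp only [centerBlock_ne_zero_iff]
      omega
  · rw [recipeBlock_of_parity_ne hpar (by omega)]
    refine hS.congr (cornerBlock_nonneg _ _ _ _) ?_ ?_
    · intro p q x y
      have hp := p.isLt
      have hq := q.isLt
      simp only [cornerBlock_ne_zero_iff]
      omega
    · intro p q hpq
      have hp := p.isLt
      have hq := q.isLt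
      by_cases h : p.val ≤ q.val
      · refine ⟨⟨a (i + 1) - 1 - p, by omega⟩, ⟨p, by omega⟩, ?_⟩
        simp only [cornerBlock_ne_zero_iff]
        omega
      · refine ⟨⟨q, by omega⟩, ⟨a (i + 1) - 1 - q, by omega⟩, ?_⟩
        simp only [cornerBlock_ne_zero_iff]
        omega

theorem isAntidiagPos_blockGram_last {r : ℕ} {a : ℕ → ℕ}
    (M : ∀ i : ℕ, Matrix (Fin (a i)) (Fin (a (i + 1))) ℂ) :
    IsAntidiagPos (blockGram r a M (r + 1)) := by
  rw [blockGram_last]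
  constructor
  · intro p q
    rw [Matrix.of_apply]
    split_ifs <;> simp
  · intro p q
    rw [Matrix.of_apply]
    split_ifs with h <;> simp [h]

theorem isAntidiagPos_blockGram_of_le {r : ℕ} {a : ℕ → ℕ}
    {M : ∀ i : ℕ, Matrix (Fin (a i)) (Fin (a (i + 1))) ℂ} {k : ℕ} (hk : k ≤ r + 1)
    (hS : IsAntidiagPos (blockGram r a M k)) {j : ℕ} (hjk : j ≤ k)
    (h : ∀ i, j ≤ i → i < k → a i ≤ a (i + 1) ∧ M i = recipeBlock a i) :
    IsAntidiagPos (blockGram r a M j) := by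
  induction hjk using Nat.decreasingInduction with
  | self => exact hS
  | of_succ j hj ih =>
    rw [blockGram_of_le M (by omega), (h j le_rfl hj).2]
    exact (ih fun i hi => h i (by omega)).recipeBlock_congr (h j le_rfl hj).1

/-! ### Sparse blocks and the blocks around a descent -/

theorem sparse_congr_degenerate {m n : ℕ} (hm : Odd m) (hn : Even n)
    {Z : Matrix (Fin m) (Fin n) ℂ} (hrank : Z.rank = m)
    (hcard : {pq : Fin m × Fin n | Z pq.1 pq.2 ≠ 0}.ncard = m)
    {S : Matrix (Fin n) (Fin n) ℂ} (hS : ∀ x y, S x y ≠ 0 → x.val + y.val + 1 = n) :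
    ∃ v ≠ 0, (Z * S * Zᵀ) *ᵥ v = 0 := by
  have hinj : ∀ u : Fin m → ℂ, u ᵥ* Z = 0 → u = 0 := by
    intro u hu
    have h1 := LinearMap.finrank_range_add_finrank_ker Zᵀ.mulVecLin
    have h2 : Module.finrank ℂ (LinearMap.range Zᵀ.mulVecLin) = m := by
      have := Matrix.rank_transpose Z
      rw [hrank] at this
      exact this
    rw [h2, Module.finrank_fin_fun, Nat.add_eq_left, Submodule.finrank_eq_zero] at h1
    have : u ∈ LinearMap.ker Zᵀ.mulVecLin := by
      rw [LinearMap.mem_ker, mulVecLin_apply, mulVec_transpose, hu]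
    rwa [h1, Submodule.mem_bot] at this
  have hrow : ∀ p, ∃ x, Z p x ≠ 0 := by
    intro p
    by_contra! h
    have := hinj (Pi.single p 1) (by rw [single_one_vecMul]; exact funext h)
    exact one_ne_zero (α := ℂ) (by simpa using congrFun this p)
  choose col hcol using hrow
  -- Full row rank puts a nonzero entry in each of the `m` rows, and there are only `m` nonzero
  -- entries.
  have huniq : ∀ p x, Z p x ≠ 0 → x = col p := by
    have hsub : Set.range (fun p => (p, col p)) ⊆ {pq : Fin m × Fin n | Z pq.1 pq.2 ≠ 0} := by
      rintro _ ⟨p, rfl⟩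
      exact hcol p
    have hc : (Set.range (fun p => (p, col p))).ncard = m := by
      rw [Set.ncard_range_of_injective (fun p q h => congrArg Prod.fst h)]
      simp
    have heq := Set.eq_of_subset_of_ncard_le hsub (by rw [hcard, hc]) (Set.toFinite _)
    intro p x hx
    have hmem : (p, x) ∈ Set.range (fun p => (p, col p)) := by
      rw [heq]
      exact hx
    obtain ⟨q, hq⟩ := hmem
    rw [Prod.mk.injEq] at hq
    rw [← hq.2, hq.1]
  have hcolinj : Function.Injective col := by
    intro p q hpq
    by_contra hne
    have := hinj (Z q (col q) • Pi.single p 1 - Z p (col p) • Pi.single q 1) (by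
      rw [sub_vecMul, smul_vecMul, smul_vecMul, single_one_vecMul, single_one_vecMul]
      funext x
      simp only [Pi.sub_apply, Pi.smul_apply, Matrix.row_apply, smul_eq_mul, Pi.zero_apply]
      by_cases hx : x = col p
      · rw [hx, ← hpq]
        ring
      · rw [not_not.1 (mt (huniq p x) hx), not_not.1 (mt (huniq q x) (hpq ▸ hx))]
        ring)
    have h' := congrFun this p
    simp [Pi.single_eq_of_ne hne, hcol q] at h'
  -- Otherwise mirroring columns is an involution of the `m` rows. As `m` is odd it has a fixed row,
  -- whose column would be its own mirror, impossible for even `n`.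
  obtain ⟨p, hp⟩ : ∃ p, ∀ q, (col q).val + (col p).val + 1 ≠ n := by
    by_contra! h
    choose f hf using h
    have hff : ∀ p, f (f p) = p := by
      intro p
      refine hcolinj (Fin.ext ?_)
      have := hf p
      have := hf (f p)
      omega
    let σ : Equiv.Perm (Fin m) := ⟨f, f, hff, hff⟩
    have hσ : σ ^ 2 ^ 1 = 1 := by
      ext p
      simp [pow_two, σ, hff]
    obtain ⟨p, hp⟩ := Equiv.Perm.exists_fixed_point_of_prime (p := 2) (n := 1)
      (by rw [Fintype.card_fin]; exact hm.not_two_dvd_nat) hσ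
    have h1 := hf p
    have h2 : f p = p := hp
    rw [h2] at h1
    obtain ⟨t, ht⟩ := hn
    omega
  refine ⟨Pi.single p 1, fun h => one_ne_zero (α := ℂ) (by simpa using congrFun h p),
    congr_mulVec_single_eq_zero hS p ?_⟩
  intro q x y hx hxy hy
  rw [huniq q x hx, huniq p y hy] at hxy
  exact hp q hxy

theorem sparseBlock_congr_degenerate {a : ℕ → ℕ} {i : ℕ} (ho : a i % 2 = 1)
    (he : a (i + 1) % 2 = 0) (hlt : a i < a (i + 1))
    {S : Matrix (Fin (a (i + 1))) (Fin (a (i + 1))) ℂ} (hS : IsAntidiagPos S) :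
    ∃ v ≠ 0, (sparseBlock a i * S * (sparseBlock a i)ᵀ) *ᵥ v = 0 := by
  refine ⟨Pi.single ⟨a i / 2, by omega⟩ 1, fun h => one_ne_zero (α := ℂ)
    (by simpa using congrFun h ⟨a i / 2, by omega⟩),
    congr_mulVec_single_eq_zero (fun x y => (hS.2 x y).1) _ ?_⟩
  intro q x y
  have hq := q.isLt
  rcases Nat.mod_two_eq_zero_or_one i with hi | hi
  · simp only [sparseBlock_of_even hi, cornerBlock_ne_zero_iff]
    omega
  · simp only [sparseBlock_of_odd hi, cornerBlock_ne_zero_iff]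
    omega

/-- The middle row of the product has a single nonzero column, and the mirror of this column is
missed by all rows because `a i < a (i+1+1)`. -/
theorem sparseBlock_congr_drop_degenerate {a : ℕ → ℕ} {i : ℕ} (ho : a i % 2 = 1)
    (he : a (i + 1) % 2 = 0) (hdrop : a (i + 1) = a (i + 1 + 1) + 1) (hlt : a i < a (i + 1 + 1))
    {S : Matrix (Fin (a (i + 1 + 1))) (Fin (a (i + 1 + 1))) ℂ} (hS : IsAntidiagPos S) :
    ∃ v ≠ 0, (sparseBlock a i * (recipeBlock a (i + 1) * S * (recipeBlock a (i + 1))ᵀ) *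
      (sparseBlock a i)ᵀ) *ᵥ v = 0 := by
  refine ⟨Pi.single ⟨a i / 2, by omega⟩ 1, fun h => one_ne_zero (α := ℂ)
    (by simpa using congrFun h ⟨a i / 2, by omega⟩),
    congr_mul_mulVec_single_eq_zero (fun x y => (hS.2 x y).1) _ ?_⟩
  intro q x y z w
  have hq := q.isLt
  have hw := w.isLt
  rcases Nat.mod_two_eq_zero_or_one i with hi | hi
  · simp only [sparseBlock_of_even hi, recipeBlock_of_drop_odd hdrop he (by omega),
      cornerBlock_ne_zero_iff]
    omega
  · simp only [sparseBlock_of_odd hi, recipeBlock_of_drop_even hdrop he (by omega),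
      cornerBlock_ne_zero_iff]
    omega

/-- The product of the two blocks is the identity matrix: the opposite parities of `i` and `i + 1`
place the larger corners so that the zero row of the second block is never met. -/
theorem IsAntidiagPos.sparseBlock_congr_drop {a : ℕ → ℕ} {i : ℕ} (he : a (i + 1) % 2 = 0)
    (hdrop : a (i + 1) = a (i + 1 + 1) + 1) (heq : a i = a (i + 1 + 1))
    {S : Matrix (Fin (a (i + 1 + 1))) (Fin (a (i + 1 + 1))) ℂ} (hS : IsAntidiagPos S) :
    IsAntidiagPos (sparseBlock a i * (recipeBlock a (i + 1) * S * (recipeBlock a (i + 1))ᵀ) *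
      (sparseBlock a i)ᵀ) := by
  rcases Nat.mod_two_eq_zero_or_one i with hi | hi
  · rw [sparseBlock_of_even hi, recipeBlock_of_drop_odd hdrop he (by omega)]
    refine hS.congr_mul (cornerBlock_nonneg _ _ _ _) (cornerBlock_nonneg _ _ _ _) ?_ ?_
    · intro p q x y z w
      have hp := p.isLt
      have hq := q.isLt
      have hx := x.isLt
      have hw := w.isLt
      simp only [cornerBlock_ne_zero_iff]
      omega
    · intro p q hle hpq
      by_cases h : p.val = q.val
      · refine ⟨⟨a i - p, by omega⟩, ⟨p, by omega⟩, ⟨q, by omega⟩, ⟨a i - q, by omega⟩, ?_⟩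
        simp only [cornerBlock_ne_zero_iff]
        omega
      · refine ⟨⟨a i - p, by omega⟩, ⟨p, by omega⟩, ⟨q, by omega⟩, ⟨a i - 1 - q, by omega⟩, ?_⟩
        simp only [cornerBlock_ne_zero_iff]
        omega
  · rw [sparseBlock_of_odd hi, recipeBlock_of_drop_even hdrop he (by omega)]
    refine hS.congr_mul (cornerBlock_nonneg _ _ _ _) (cornerBlock_nonneg _ _ _ _) ?_ ?_
    · intro p q x y z w
      have hp := p.isLt
      have hq := q.isLt
      have hx := x.isLt
      have hw := w.isLt
      simp only [cornerBlock_ne_zero_iff]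
      omega
    · intro p q hle hpq
      by_cases h : p.val = q.val
      · refine ⟨⟨a i - 1 - p, by omega⟩, ⟨p, by omega⟩, ⟨q, by omega⟩, ⟨a i - 1 - q, by omega⟩, ?_⟩
        simp only [cornerBlock_ne_zero_iff]
        omega
      · refine ⟨⟨a i - p, by omega⟩, ⟨p, by omega⟩, ⟨q, by omega⟩, ⟨a i - 1 - q, by omega⟩, ?_⟩
        simp only [cornerBlock_ne_zero_iff]
        omega

/-- The block at the descent has one zero row next to its centre, and the centred block has a row
selecting precisely it. The parity of the index decides on which side of the centre it lies. -/
theorem exists_vecMul_eq_zero_of_drop_even {a : ℕ → ℕ} {i : ℕ} (hpos : 0 < a i)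
    (ho : a i % 2 = 0) (he : a (i + 1) % 2 = 0) (hdrop : a (i + 1) = a (i + 1 + 1) + 1)
    (hle : a i ≤ a (i + 1 + 1)) :
    ∃ v ≠ 0, v ᵥ* (recipeBlock a i * recipeBlock a (i + 1)) = 0 := by
  rw [recipeBlock_of_parity_eq (show a i % 2 = a (i + 1) % 2 by omega)]
  have key : ∀ (p : Fin (a i)) (s t : ℕ),
      (∀ x y, p.val + x + 1 = a i + (a (i + 1) - a i) / 2 → y < a (i + 1 + 1) →
        ¬ ((x < s ∧ x + y + 1 = a (i + 1 + 1)) ∨ (y < t ∧ x + y + 1 = a (i + 1)))) →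
      ∃ v ≠ 0, v ᵥ* (centerBlock (a i) (a (i + 1)) *
        cornerBlock (a (i + 1)) (a (i + 1 + 1)) s t) = 0 := by
    intro p s t h
    refine ⟨Pi.single p 1, fun h => one_ne_zero (α := ℂ) (by simpa using congrFun h p), ?_⟩
    rw [single_one_vecMul]
    funext y
    by_contra h0
    rw [Matrix.row_apply] at h0
    obtain ⟨x, hx, hxy⟩ := (mul_apply_ne_zero_iff (centerBlock_nonneg _ _)
      (cornerBlock_nonneg _ _ _ _) _ _).1 h0
    rw [centerBlock_ne_zero_iff] at hx
    rw [cornerBlock_ne_zero_iff] at hxy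
    exact h x y hx y.isLt hxy
  rcases Nat.mod_two_eq_zero_or_one i with hi | hi
  · rw [recipeBlock_of_drop_odd hdrop he (by omega)]
    refine key ⟨a i / 2, by omega⟩ _ _ ?_
    simp only
    omega
  · rw [recipeBlock_of_drop_even hdrop he (by omega)]
    refine key ⟨a i / 2 - 1, by omega⟩ _ _ ?_
    simp only
    omega

/-- In the block at the descent the middle row is the sum of its two neighbours, and as `a i ≥ 3`
the centred block selects all three. -/
theorem exists_vecMul_eq_zero_of_drop_odd {a : ℕ → ℕ} {i : ℕ} (hi : 1 < a i)
    (ho : a i % 2 = 1) (he : a (i + 1) % 2 = 1) (hdrop : a (i + 1) = a (i + 1 + 1) + 1)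
    (hle : a i ≤ a (i + 1 + 1)) :
    ∃ v ≠ 0, v ᵥ* (recipeBlock a i * recipeBlock a (i + 1)) = 0 := by
  rw [recipeBlock_of_parity_eq (show a i % 2 = a (i + 1) % 2 by omega),
    recipeBlock_of_parity_ne (by omega) (by omega)]
  set C := cornerBlock (a (i + 1)) (a (i + 1 + 1)) ((a (i + 1) + 1) / 2) ((a (i + 1) + 1) / 2)
    with hC
  have hmul : ∀ (p : Fin (a i)) (x : Fin (a (i + 1))) (y : Fin (a (i + 1 + 1))),
      p.val + x.val + 1 = a i + (a (i + 1) - a i) / 2 →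
      (centerBlock (a i) (a (i + 1)) * C) p y = C x y := by
    intro p x y hpx
    rw [Matrix.mul_apply, Finset.sum_eq_single x]
    · rw [centerBlock, if_pos hpx, one_mul]
    · intro z _ hz
      rw [centerBlock, if_neg, zero_mul]
      intro h
      exact hz (Fin.ext (by omega))
    · simp
  refine ⟨Pi.single ⟨a i / 2 - 1, by omega⟩ 1 - Pi.single ⟨a i / 2, by omega⟩ 1 +
    Pi.single ⟨a i / 2 + 1, by omega⟩ 1, ?_, ?_⟩
  · intro h
    have := congrFun h ⟨a i / 2, by omega⟩
    rw [Pi.add_apply, Pi.sub_apply, Pi.single_eq_same, Pi.single_eq_of_ne, Pi.single_eq_of_ne]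
      at this
    · simp at this
    · simp
    · rw [Ne, Fin.mk.injEq]
      omega
  · rw [add_vecMul, sub_vecMul, single_one_vecMul, single_one_vecMul, single_one_vecMul]
    funext y
    simp only [Pi.add_apply, Pi.sub_apply, Matrix.row_apply, Pi.zero_apply]
    rw [hmul _ ⟨a (i + 1) / 2 + 1, by omega⟩ y (by simp only; omega),
      hmul _ ⟨a (i + 1) / 2, by omega⟩ y (by simp only; omega),
      hmul _ ⟨a (i + 1) / 2 - 1, by omega⟩ y (by simp only; omega), hC]
    have hy := y.isLt
    simp only [cornerBlock]
    by_cases h1 : y.val = a (i + 1) / 2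
    · rw [if_neg (by omega), if_pos (by omega), if_pos (by omega)]
      ring
    · by_cases h2 : y.val + 1 = a (i + 1) / 2
      · rw [if_pos (by omega), if_pos (by omega), if_neg (by omega)]
        ring
      · rw [if_neg (by omega), if_neg (by omega), if_neg (by omega)]
        ring

/-- The doubled middle row supplies both mirrored columns. If `a i = a (i+1+1)`, one of its ones
meets the zero row of the next block, while the other reaches the middle column, which is its own
mirror. -/
theorem IsAntidiagPos.recipeBlock_congr_drop_odd_even {a : ℕ → ℕ} {i : ℕ}
    (ho : a i % 2 = 1) (he : a (i + 1) % 2 = 0) (hdrop : a (i + 1) = a (i + 1 + 1) + 1)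
    (hle : a i ≤ a (i + 1 + 1)) {S : Matrix (Fin (a (i + 1 + 1))) (Fin (a (i + 1 + 1))) ℂ}
    (hS : IsAntidiagPos S) :
    IsAntidiagPos (recipeBlock a i * (recipeBlock a (i + 1) * S * (recipeBlock a (i + 1))ᵀ) *
      (recipeBlock a i)ᵀ) := by
  rw [recipeBlock_of_parity_ne (show a i % 2 ≠ a (i + 1) % 2 by omega) (by omega)]
  rcases Nat.mod_two_eq_zero_or_one i with hi | hi
  · rw [recipeBlock_of_drop_odd hdrop he (by omega)]
    refine hS.congr_mul (cornerBlock_nonneg _ _ _ _) (cornerBlock_nonneg _ _ _ _) ?_ ?_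
    · intro p q x y z w
      have hp := p.isLt
      have hq := q.isLt
      have hx := x.isLt
      have hw := w.isLt
      simp only [cornerBlock_ne_zero_iff]
      omega
    · intro p q hlepq hpq
      by_cases h : p.val + 1 < a (i + 1) / 2
      · refine ⟨⟨a (i + 1) - 1 - p, by omega⟩, ⟨p, by omega⟩,
          ⟨a (i + 1 + 1) - 1 - p, by omega⟩, ⟨p, by omega⟩, ?_⟩
        simp only [cornerBlock_ne_zero_iff]
        omega
      · refine ⟨⟨a (i + 1) - 1 - p, by omega⟩, ⟨p, by omega⟩,
          ⟨a (i + 1 + 1) - 1 - p, by omega⟩, ⟨p + 1, by omega⟩, ?_⟩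
        simp only [cornerBlock_ne_zero_iff]
        omega
  · rw [recipeBlock_of_drop_even hdrop he (by omega)]
    refine hS.congr_mul (cornerBlock_nonneg _ _ _ _) (cornerBlock_nonneg _ _ _ _) ?_ ?_
    · intro p q x y z w
      have hp := p.isLt
      have hq := q.isLt
      have hx := x.isLt
      have hw := w.isLt
      simp only [cornerBlock_ne_zero_iff]
      omega
    · intro p q hlepq hpq
      by_cases h : p.val + 1 < a (i + 1) / 2
      · refine ⟨⟨a (i + 1) - 1 - p, by omega⟩, ⟨p, by omega⟩,
          ⟨a (i + 1 + 1) - 1 - p, by omega⟩, ⟨p, by omega⟩, ?_⟩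
        simp only [cornerBlock_ne_zero_iff]
        omega
      · refine ⟨⟨p, by omega⟩, ⟨p, by omega⟩, ⟨p, by omega⟩, ⟨p, by omega⟩, ?_⟩
        simp only [cornerBlock_ne_zero_iff]
        omega

/-- The corners of the first block never select the middle row of the second, the only one with two
ones. -/
theorem IsAntidiagPos.recipeBlock_congr_drop_even_odd {a : ℕ → ℕ} {i : ℕ}
    (ho : a i % 2 = 0) (he : a (i + 1) % 2 = 1) (hdrop : a (i + 1) = a (i + 1 + 1) + 1)
    (hle : a i ≤ a (i + 1 + 1)) {S : Matrix (Fin (a (i + 1 + 1))) (Fin (a (i + 1 + 1))) ℂ}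
    (hS : IsAntidiagPos S) :
    IsAntidiagPos (recipeBlock a i * (recipeBlock a (i + 1) * S * (recipeBlock a (i + 1))ᵀ) *
      (recipeBlock a i)ᵀ) := by
  rw [recipeBlock_of_parity_ne (show a i % 2 ≠ a (i + 1) % 2 by omega) (by omega),
    recipeBlock_of_parity_ne (i := i + 1) (by omega) (by omega)]
  refine hS.congr_mul (cornerBlock_nonneg _ _ _ _) (cornerBlock_nonneg _ _ _ _) ?_ ?_
  · intro p q x y z w
    have hp := p.isLt
    have hq := q.isLt
    have hx := x.isLt
    have hw := w.isLt
    simp only [cornerBlock_ne_zero_iff]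
    omega
  · intro p q hlepq hpq
    refine ⟨⟨a (i + 1) - 1 - p, by omega⟩, ⟨p, by omega⟩,
      ⟨a (i + 1 + 1) - 1 - p, by omega⟩, ⟨p, by omega⟩, ?_⟩
    simp only [cornerBlock_ne_zero_iff]
    omega

theorem IsAntidiagPos.recipeBlock_congr_drop_one {a : ℕ → ℕ} {i : ℕ}
    (ho : a i = 1) (he : a (i + 1) % 2 = 1) (hdrop : a (i + 1) = a (i + 1 + 1) + 1)
    (hle : a i ≤ a (i + 1 + 1)) {S : Matrix (Fin (a (i + 1 + 1))) (Fin (a (i + 1 + 1))) ℂ}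
    (hS : IsAntidiagPos S) :
    IsAntidiagPos (recipeBlock a i * (recipeBlock a (i + 1) * S * (recipeBlock a (i + 1))ᵀ) *
      (recipeBlock a i)ᵀ) := by
  rw [recipeBlock_of_parity_eq (show a i % 2 = a (i + 1) % 2 by omega),
    recipeBlock_of_parity_ne (i := i + 1) (by omega) (by omega)]
  refine hS.congr_mul (centerBlock_nonneg _ _) (cornerBlock_nonneg _ _ _ _) ?_ ?_
  · intro p q x y z w _ _ _ _ _
    have hp := p.isLt
    have hq := q.isLt
    omega
  · intro p q hlepq hpq
    refine ⟨⟨a (i + 1) / 2, by omega⟩, ⟨a (i + 1) / 2 - 1, by omega⟩,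
      ⟨a (i + 1) / 2, by omega⟩, ⟨a (i + 1) / 2, by omega⟩, ?_⟩
    simp only [cornerBlock_ne_zero_iff, centerBlock_ne_zero_iff]
    omega

theorem recipeBlock_congr_drop_dichotomy {a : ℕ → ℕ} {i : ℕ} (hpos : 0 < a i)
    (hdrop : a (i + 1) = a (i + 1 + 1) + 1) (hle : a i ≤ a (i + 1 + 1))
    {S : Matrix (Fin (a (i + 1 + 1))) (Fin (a (i + 1 + 1))) ℂ} (hS : IsAntidiagPos S) :
    (∃ v ≠ 0, (recipeBlock a i * (recipeBlock a (i + 1) * S * (recipeBlock a (i + 1))ᵀ) *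
      (recipeBlock a i)ᵀ) *ᵥ v = 0) ∨
    IsAntidiagPos (recipeBlock a i * (recipeBlock a (i + 1) * S * (recipeBlock a (i + 1))ᵀ) *
      (recipeBlock a i)ᵀ) := by
  rcases Nat.mod_two_eq_zero_or_one (a i) with h | h <;>
    rcases Nat.mod_two_eq_zero_or_one (a (i + 1)) with h' | h'
  · obtain ⟨v, hv, hv0⟩ := exists_vecMul_eq_zero_of_drop_even hpos h h' hdrop hle
    exact Or.inl ⟨v, hv, congr_mul_mulVec_eq_zero S hv0⟩
  · exact Or.inr (hS.recipeBlock_congr_drop_even_odd h h' hdrop hle)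
  · exact Or.inr (hS.recipeBlock_congr_drop_odd_even h h' hdrop hle)
  · by_cases h1 : a i = 1
    · exact Or.inr (hS.recipeBlock_congr_drop_one h1 h' hdrop hle)
    · obtain ⟨v, hv, hv0⟩ := exists_vecMul_eq_zero_of_drop_odd (by omega) h h' hdrop hle
      exact Or.inl ⟨v, hv, congr_mul_mulVec_eq_zero S hv0⟩

/-! ### Assembling the criteria -/

theorem not_isRichardson_of_isUnimodal {r : ℕ} {a : ℕ → ℕ} (hu : IsUnimodal r a) {i : ℕ}
    (hi1 : 1 ≤ i) (hir : i ≤ r) (ho : Odd (a i)) (he : Even (a (i + 1)))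
    {Z : Matrix (Fin (a i)) (Fin (a (i + 1))) ℂ} (hZ : IsSparse a i Z) :
    ¬ IsRichardson r a (normalFormReplaced r a i Z) := by
  rw [isUnimodal_iff] at hu
  have hS := isAntidiagPos_blockGram_of_le (M := Function.update (recipeBlock a) i Z)
    (k := r + 1) le_rfl
    (isAntidiagPos_blockGram_last _) (j := i + 1) (by omega) fun k hk hk' =>
      ⟨hu k (by omega) (by omega), Function.update_of_ne (by omega) _ _⟩
  obtain ⟨v, hv, hv0⟩ := sparse_congr_degenerate ho he hZ.1 hZ.2 fun x y => (hS.2 x y).1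
  refine not_isRichardson_of_gram hi1 hir (hu i hi1 hir) hv ?_
  rw [blockGram_of_le _ hir, Function.update_self, hv0]

theorem isRichardson_sparseBlock_iff {r : ℕ} {a : ℕ → ℕ}
    (hpos : ∀ k, 1 ≤ k → k ≤ r + 1 → 0 < a k) {l : ℕ} (hlr : l ≤ r)
    (hd : HasDescentAt r a l) {i : ℕ} (hi1 : 1 ≤ i) (hil : i < l) (ho : Odd (a i))
    (he : Even (a (i + 1))) (hlt : a i < a (i + 1)) :
    IsRichardson r a (normalFormReplaced r a i (sparseBlock a i)) ↔
      i + 1 = l ∧ a i = a (i + 1 + 1) := by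
  rw [Nat.odd_iff] at ho
  rw [Nat.even_iff] at he
  have hcst : ∀ k, l + 1 ≤ k → k < r + 1 → a k ≤ a (k + 1) := fun k hk hk' => by
    rw [hd.const k (by omega) (by omega), hd.const (k + 1) (by omega) (by omega)]
  set M := Function.update (recipeBlock a) i (sparseBlock a i) with hM
  have hMi : M i = sparseBlock a i := Function.update_self _ _ _
  have hMne : ∀ k, k ≠ i → M k = recipeBlock a k := fun k hk => Function.update_of_ne hk _ _
  have hS := isAntidiagPos_blockGram_of_le (M := M) (k := r + 1) le_rfl
    (isAntidiagPos_blockGram_last _) (j := l + 1) (by omega) fun k hk hk' =>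
      ⟨hcst k hk hk', hMne k (by omega)⟩
  by_cases hl : i + 1 = l
  · subst hl
    have hle : a i ≤ a (i + 1 + 1) := hd.le (by omega)
    have hgi : blockGram r a M i = sparseBlock a i * (recipeBlock a (i + 1) *
        blockGram r a M (i + 1 + 1) * (recipeBlock a (i + 1))ᵀ) * (sparseBlock a i)ᵀ := by
      rw [blockGram_of_le M (j := i) (by omega), blockGram_of_le M (j := i + 1) hlr, hMi,
        hMne (i + 1) (by omega)]
    constructor
    · intro hR
      refine ⟨rfl, ?_⟩
      by_contra hne
      obtain ⟨v, hv, hv0⟩ := sparseBlock_congr_drop_degenerate ho he hd.drop (by omega) hS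
      exact not_isRichardson_of_gram hi1 (by omega) hlt.le hv (by rw [hgi, hv0]) hR
    · rintro ⟨-, heq⟩
      have hSi : IsAntidiagPos (blockGram r a M i) := by
        rw [hgi]
        exact hS.sparseBlock_congr_drop he hd.drop heq
      have hall : ∀ j, 1 ≤ j → j ≤ r + 1 → j ≠ i + 1 → IsAntidiagPos (blockGram r a M j) := by
        intro j hj1 hj hjl
        rcases Nat.lt_or_ge i j with h | h
        · exact isAntidiagPos_blockGram_of_le le_rfl (isAntidiagPos_blockGram_last _) hj
            fun k hk hk' => ⟨hcst k (by omega) hk', hMne k (by omega)⟩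
        · exact isAntidiagPos_blockGram_of_le (by omega) hSi h
            fun k hk hk' => ⟨hd.mono k (by omega) (by omega), hMne k (by omega)⟩
      refine isRichardson_of_hasDescentAt (ofBlocks_mem_gradeOne _ _ _) (by omega) hlr hd heq ?_
      intro d hdr hdl u hu hu0
      obtain ⟨v, rfl⟩ := exists_eq_oppVec (j := r + 1 - d) (by omega) (by omega) (by omega) hu
      change ofBlocks r a M ^ _ *ᵥ _ = 0 at hu0
      rw [pow_mulVec_oppVec M d _ (by omega) (by omega), smul_eq_zero] at hu0
      have hv : v = 0 := by
        refine (hall (r + 1 - d) (by omega) (by omega) (by omega)).eq_zero_of_mulVec ?_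
        by_contra h0
        exact blockVec_ne_zero (by omega) (by omega) h0
          (hu0.resolve_left (pow_ne_zero _ (by norm_num)))
      rw [hv]
      funext x
      simp [oppVec, blockVec, extendZero]
  -- The descent lies beyond the replaced block, so `X` agrees with the normal form there. Either
  -- the Gram matrix just before the descent is singular, or it is antidiagonal and the argument for
  -- increasing steps applies at `i`.
  · refine iff_of_false (fun hR => ?_) fun h => hl h.1
    obtain ⟨k, rfl⟩ : ∃ k, l = k + 1 := ⟨l - 1, by omega⟩
    have hle : a k ≤ a (k + 1 + 1) := hd.le (by omega)
    have hgk : blockGram r a M k = recipeBlock a k * (recipeBlock a (k + 1) *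
        blockGram r a M (k + 1 + 1) * (recipeBlock a (k + 1))ᵀ) * (recipeBlock a k)ᵀ := by
      rw [blockGram_of_le M (j := k) (by omega), blockGram_of_le M (j := k + 1) hlr, hMne k (by omega),
        hMne (k + 1) (by omega)]
    rcases recipeBlock_congr_drop_dichotomy (hpos k (by omega) (by omega)) hd.drop hle hS with
      ⟨v, hv, hv0⟩ | h
    · exact not_isRichardson_of_gram (by omega) (by omega) (hd.mono k (by omega) (by omega)) hv
        (by rw [hgk, hv0]) hR
    · rw [← hgk] at h
      have hSi := isAntidiagPos_blockGram_of_le (by omega) h (j := i + 1) (by omega)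
        fun k hk hk' => ⟨hd.mono k (by omega) (by omega), hMne k (by omega)⟩
      obtain ⟨v, hv, hv0⟩ := sparseBlock_congr_degenerate ho he hlt hSi
      exact not_isRichardson_of_gram hi1 (by omega) hlt.le hv
        (by rw [blockGram_of_le M (j := i) (by omega), hMi, hv0]) hR

theorem isRichardson_normalFormReplaced_iff {r : ℕ} {a : ℕ → ℕ}
    (hpos : ∀ k, 1 ≤ k → k ≤ r + 1 → 0 < a k) (hnice : IsNice r a) {i : ℕ} (hi1 : 1 ≤ i)
    (hir : i ≤ r) (ho : Odd (a i)) (he : Even (a (i + 1))) (hlt : a i < a (i + 1))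
    {Z : Matrix (Fin (a i)) (Fin (a (i + 1))) ℂ} (hZ : IsReplacement r a i Z) :
    IsRichardson r a (normalFormReplaced r a i Z) ↔
      Odd (totalSize r a) ∧
        ∃ l, l ≤ r ∧ i + 1 = l ∧ a (l - 1) = a (l + 1) ∧ a (l + 1) < a l := by
  by_cases hu : IsUnimodal r a
  · refine iff_of_false (not_isRichardson_of_isUnimodal hu hi1 hir ho he (hZ.1 hu)) ?_
    rintro ⟨-, l, hlr, rfl, -, hl⟩
    exact absurd (isUnimodal_iff.1 hu (i + 1) (by omega) hlr) (by omega)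
  · obtain ⟨X, hX, hXR⟩ := hnice
    obtain rfl := hZ.2 hu
    rw [isUnimodal_iff] at hu
    push Not at hu
    obtain ⟨l, hl1, hlr, hl⟩ := hu
    have hd := hXR.hasDescentAt hX hl1 hlr hl
    -- At or after the descent no step increases, contrary to `hlt`.
    have hil : i < l := by
      by_contra h
      rcases Nat.eq_or_lt_of_not_lt h with h' | h'
      · subst h'
        omega
      · have := hd.const i (by omega) (by omega)
        have := hd.const (i + 1) (by omega) (by omega)
        omega
    rw [isRichardson_sparseBlock_iff hpos hlr hd hi1 hil ho he hlt, odd_totalSize_iff]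
    constructor
    · rintro ⟨rfl, heq⟩
      refine ⟨?_, i + 1, hlr, rfl, heq, hl⟩
      rw [hd.const (r + 1) (by omega) le_rfl, ← heq]
      exact ho
    · rintro ⟨-, m, hmr, rfl, heq, hm⟩
      refine ⟨?_, heq⟩
      by_contra hne
      have hmono := hd.mono (i + 1) (by omega) (by omega)
      omega

end

theorem mainTheorem2 (r : ℕ) (a : ℕ → ℕ)
    (hpos : ∀ k, 1 ≤ k → k ≤ r + 1 → 0 < a k) (hnice : IsNice r a) :
    (∀ i, 1 ≤ i → i ≤ r → Odd (a i) → Even (a (i + 1)) → a i < a (i + 1) →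
      ∀ Z : Matrix (Fin (a i)) (Fin (a (i + 1))) ℂ, IsReplacement r a i Z →
        (IsRichardson r a (normalFormReplaced r a i Z) ↔
          Odd (totalSize r a) ∧
            ∃ l, l ≤ r ∧ i + 1 = l ∧ a (l - 1) = a (l + 1) ∧ a (l + 1) < a l)) ∧
    (IsUnimodal r a → ∀ i, 1 ≤ i → i ≤ r → Odd (a i) → Even (a (i + 1)) →
      ∀ Z : Matrix (Fin (a i)) (Fin (a (i + 1))) ℂ, IsSparse a i Z →
        ¬ IsRichardson r a (normalFormReplaced r a i Z)) ∧
    (Odd (totalSize r a) → ∀ l, 2 ≤ l → l ≤ r → a l = a (l + 1) + 1 → Odd (a (l - 1)) →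
      (IsRichardson r a (normalFormReplaced r a (l - 1) (sparseBlock a (l - 1))) ↔
        a (l - 1) = a (l + 1))) := by
  refine ⟨fun i hi1 hir ho he hlt Z hZ =>
      isRichardson_normalFormReplaced_iff hpos hnice hi1 hir ho he hlt hZ,
    fun hu i hi1 hir ho he Z hZ => not_isRichardson_of_isUnimodal hu hi1 hir ho he hZ, ?_⟩
  intro hN l hl2 hlr hdrop ho
  obtain ⟨i, rfl⟩ : ∃ i, l = i + 1 := ⟨l - 1, by omega⟩
  obtain ⟨X, hX, hXR⟩ := hnice
  have hd := hXR.hasDescentAt hX (by omega) hlr (by omega)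
  have hle : a i ≤ a (i + 1 + 1) := hd.le hl2
  -- The sequence is constant after the descent, so odd total size makes `a (l+1)` odd and hence `a
  -- l` even.
  have he : Even (a (i + 1)) := by
    rw [odd_totalSize_iff, hd.const (r + 1) (by omega) le_rfl] at hN
    rw [hdrop]
    exact hN.add_one
  rw [Nat.add_sub_cancel] at ho ⊢
  rw [isRichardson_sparseBlock_iff hpos hlr hd (by omega) (by omega) ho he (by omega)]
  simp
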